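/- **Theorem (convergence of the fast scheme).** Let $0<\alpha<1$, $\rho\ge 0$, $D,\ell,T>0$, $r\ge 1$, and let ${}_0^CD_t^{(\alpha,\rho)}v(t)=\frac{e^{-\rho t}}{\Gamma(1-\alpha)}\int_0^t \frac{(e^{\rho s}v(s))'}{(t-s)^{\alpha}}\,ds$ be the Caputo tempered derivative. Let $u$ solve $${}_0^CD_t^{(\alpha,\rho)}u=D\,\partial_x^2u+f \ \text{ on } (0,\ell)\times(0,T],\qquad u(x,0)=\psi(x)\ (0\le x\le \ell),\qquad u(0,t)=u(\ell,t)=0\ (0<t\le T).$$ Assume that $u(\cdot,t)$ is continuous on $[0,\ell]$ and $C^4$ on $(0,\ell)$ for every $t\in(0,T]$, that $u(x,\cdot)$ is continuous on $[0,T]$ and $C^2$ on $(0,T)$ for every $x\in(0,\ell)$, and that for some constant $K$ one has $|\partial_x^4u|\le K$ on $(0,\ell)\times(0,T]$ and $|\partial_t^mu(x,t)|\le K(1+t^{\alpha-m})$ for $m=0,1,2$ on $(0,\ell)\times(0,T)$. For integers $M,N\ge1$ let $h=\ell/M$, $x_i=ih$ $(0\le i\le M)$, $t_n=T(n/N)^r$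 $(0\le n\le N)$, $\tau_n=t_n-t_{n-1}$, and $\sigma=\min_{1\le n\le N}\tau_n$. A sum-of-exponentials approximation of precision $\epsilon>0$ consists of $\omega_i,s_i>0$ $(1\le i\le N_{\exp})$ with $\bigl|t^{-1-\alpha}-\sum_{i}\omega_ie^{-s_it}\bigr|\le\epsilon$ for all $t\in[\sigma,T]$. For a grid function $(v^n)$ put $H_i^1=0$ and, with $\lambda_i=\rho+s_i$, for $n\ge2$ $$H_i^n=e^{-\lambda_i\tau_n}H_i^{n-1}+\frac{e^{-\lambda_i\tau_n}}{\lambda_i^2\tau_{n-1}}\Bigl[(e^{-\lambda_i\tau_{n-1}}-1+\lambda_i\tau_{n-1})v^{n-1}+(1-e^{-\lambda_i\tau_{n-1}}-e^{-\lambda_i\tau_{n-1}}\lambda_i\tau_{n-1})v^{n-2}\Bigr].$$ The fast discrete derivative is $\mathbb D v^1=\frac{v^1-e^{-\rho\tau_1}v^0}{\tau_1^\alpha\Gamma(2-\alpha)}$ and, for $n\ge2$, $$\mathbb D v^n=\frac{v^n-e^{-\rho\tau_n}v^{n-1}}{\tau_n^\alpha\Gamma(2-\alpha)}+\frac{e^{-\rho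 t_n}}{\Gamma(1-\alpha)}\Bigl[\frac{e^{\rho t_{n-1}}v^{n-1}}{\tau_n^\alpha}-\frac{v^0}{t_n^\alpha}-\alpha\sum_{i}\omega_ie^{\rho t_n}H_i^n\Bigr].$$ The fast scheme seeks $U_i^n$ $(0\le i\le M,\ 0\le n\le N)$ with $$\mathbb D U_i^n=D\,\frac{U_{i-1}^n-2U_i^n+U_{i+1}^n}{h^2}+f(x_i,t_n)\quad(1\le i\le M-1,\ 1\le n\le N),$$ $U_0^n=U_M^n=0$ for $1\le n\le N$, and $U_i^0=\psi(x_i)$ for $0\le i\le M$. Then for every $\epsilon_0>0$ there is a constant $C>0$, independent of $M$, $N$, $\epsilon$ and of the chosen sum-of-exponentials approximation, such that for all $M,N\ge1$, all $0<\epsilon\le\epsilon_0$, every sum-of-exponentials approximation of precision $\epsilon$, every solution $U$ of the fast scheme, and all $0\le n\le N$, $$\max_{0\le i\le M}|u(x_i,t_n)-U_i^n|\le C\bigl(h^2+T^\alpha N^{-\min\{2-\alpha,\,r\alpha\}}+\epsilon\bigr).$$ -/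

import Mathlib

open Set

noncomputable section

namespace TemperedDiffusion

/-- The Caputo tempered derivative of order `α` and tempering parameter `ρ` of `v` at `t`:
`e^{-ρ t} / Γ(1-α) * ∫₀ᵗ (e^{ρ s} v(s))' (t-s)^{-α} ds`. -/
def temperedCaputo (α ρ : ℝ) (v : ℝ → ℝ) (t : ℝ) : ℝ :=
  Real.exp (-ρ * t) / Real.Gamma (1 - α) *
    ∫ s in (0 : ℝ)..t, deriv (fun y => Real.exp (ρ * y) * v y) s * (t - s) ^ (-α)

/-- `u` solves the tempered diffusion problem on `(0,ℓ) × (0,T]` with source `f`, initial value `ψ`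
and homogeneous Dirichlet boundary values. -/
structure IsSolution (α ρ D ℓ T : ℝ) (f : ℝ → ℝ → ℝ) (ψ : ℝ → ℝ) (u : ℝ → ℝ → ℝ) : Prop where
  equation : ∀ x ∈ Ioo 0 ℓ, ∀ t ∈ Ioc 0 T,
    temperedCaputo α ρ (fun s => u x s) t = D * iteratedDeriv 2 (fun y => u y t) x + f x t
  initial : ∀ x ∈ Icc 0 ℓ, u x 0 = ψ x
  boundary_left : ∀ t ∈ Ioc 0 T, u 0 t = 0
  boundary_right : ∀ t ∈ Ioc 0 T, u ℓ t = 0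

/-- Regularity of the exact solution: the fourth space derivative is bounded (so that the central
difference is second order), and the time derivatives up to order two satisfy
`|∂ₜᵐ u| ≤ K (1 + t^{α-m})`, which allows the typical weak singularity at `t = 0`. -/
structure IsRegular (α ℓ T : ℝ) (u : ℝ → ℝ → ℝ) : Prop where
  space_cont : ∀ t ∈ Ioc 0 T, ContinuousOn (fun x => u x t) (Icc 0 ℓ)
  space_contDiff : ∀ t ∈ Ioc 0 T, ContDiffOn ℝ 4 (fun x => u x t) (Ioo 0 ℓ)
  space_bound : ∃ K : ℝ, ∀ t ∈ Ioc 0 T, ∀ x ∈ Ioo 0 ℓ, |iteratedDeriv 4 (fun y => u y t) x| ≤ K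
  time_cont : ∀ x ∈ Ioo 0 ℓ, ContinuousOn (fun t => u x t) (Icc 0 T)
  time_contDiff : ∀ x ∈ Ioo 0 ℓ, ContDiffOn ℝ 2 (fun t => u x t) (Ioo 0 T)
  time_bound : ∃ K : ℝ, ∀ x ∈ Ioo 0 ℓ, ∀ t ∈ Ioo 0 T, ∀ m : ℕ, m ≤ 2 →
    |iteratedDeriv m (fun s => u x s) t| ≤ K * (1 + t ^ (α - (m : ℝ)))

/-- The graded time mesh `t_n = T (n / N)^r`. -/
def meshTime (T r : ℝ) (N n : ℕ) : ℝ := T * ((n : ℝ) / (N : ℝ)) ^ r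

/-- The step `τ_n = t_n - t_{n-1}` (used for `n ≥ 1` only). -/
def meshStep (T r : ℝ) (N n : ℕ) : ℝ := meshTime T r N n - meshTime T r N (n - 1)

/-- The smallest time step `σ = min_{1 ≤ n ≤ N} τ_n`. -/
def minStep (T r : ℝ) (N : ℕ) : ℝ := ⨅ k : Fin N, meshStep T r N ((k : ℕ) + 1)

/-- `∑ ω_i e^{-s_i t}`, with positive nodes and weights, approximates the kernel `t^{-β}` on
`[σ, T]` with absolute precision `ε`. -/
structure IsSOE (β σ T ε : ℝ) {Q : ℕ} (ω s : Fin Q → ℝ) : Prop where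
  weight_pos : ∀ i, 0 < ω i
  node_pos : ∀ i, 0 < s i
  approx : ∀ t ∈ Icc σ T, |t ^ (-β) - ∑ i, ω i * Real.exp (-s i * t)| ≤ ε

/-- The discrete history of the grid function `v` for the exponential with rate `μ` (later
`μ = ρ + s_i`). The value at index `n` approximates `∫₀^{t_{n-1}} e^{-μ (t_n - y)} v(y) dy`; it is
computed by the one-step recurrence in which `v` is interpolated linearly on the newest
interval `[t_{n-2}, t_{n-1}]`. -/
def history (T r : ℝ) (N : ℕ) (μ : ℝ) (v : ℕ → ℝ) : ℕ → ℝ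
  | 0 => 0
  | 1 => 0
  | n + 2 =>
    let τ := meshStep T r N (n + 1)
    Real.exp (-μ * meshStep T r N (n + 2)) * history T r N μ v (n + 1) +
      Real.exp (-μ * meshStep T r N (n + 2)) / (μ ^ 2 * τ) *
        ((Real.exp (-μ * τ) - 1 + μ * τ) * v (n + 1) +
          (1 - Real.exp (-μ * τ) - Real.exp (-μ * τ) * (μ * τ)) * v n)

/-- The fast discrete Caputo tempered derivative at `t_n`, `n ≥ 1`, of the grid function `v`. -/
def fastCaputo (α ρ T r : ℝ) (N : ℕ) {Q : ℕ} (ω s : Fin Q → ℝ) (v : ℕ → ℝ) (n : ℕ) : ℝ :=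
  if n = 1 then
    (v 1 - Real.exp (-ρ * meshStep T r N 1) * v 0) /
      (meshStep T r N 1 ^ α * Real.Gamma (2 - α))
  else
    (v n - Real.exp (-ρ * meshStep T r N n) * v (n - 1)) /
        (meshStep T r N n ^ α * Real.Gamma (2 - α)) +
      Real.exp (-ρ * meshTime T r N n) / Real.Gamma (1 - α) *
        (Real.exp (ρ * meshTime T r N (n - 1)) * v (n - 1) / meshStep T r N n ^ α -
          v 0 / meshTime T r N n ^ α -
          α * ∑ i, ω i * Real.exp (ρ * meshTime T r N n) * history T r N (ρ + s i) v n)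

/-- The second-order central difference quotient at the node `i ≥ 1`. -/
def centralDiff (h : ℝ) (w : ℕ → ℝ) (i : ℕ) : ℝ := (w (i - 1) - 2 * w i + w (i + 1)) / h ^ 2

/-- `U i n` is a solution of the fast finite difference scheme on the space grid
`x_i = i ℓ / M`, `0 ≤ i ≤ M`, and the graded time mesh `t_n`, `0 ≤ n ≤ N`. -/
structure IsFastScheme (α ρ D ℓ T r : ℝ) (f : ℝ → ℝ → ℝ) (ψ : ℝ → ℝ) (M N : ℕ) {Q : ℕ}
    (ω s : Fin Q → ℝ) (U : ℕ → ℕ → ℝ) : Prop where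
  equation : ∀ i n : ℕ, 1 ≤ i → i < M → 1 ≤ n → n ≤ N →
    fastCaputo α ρ T r N ω s (fun k => U i k) n =
      D * centralDiff (ℓ / M) (fun j => U j n) i + f (i * (ℓ / M)) (meshTime T r N n)
  boundary_left : ∀ n : ℕ, 0 < n → n ≤ N → U 0 n = 0
  boundary_right : ∀ n : ℕ, 0 < n → n ≤ N → U M n = 0
  initial : ∀ i : ℕ, i ≤ M → U i 0 = ψ (i * (ℓ / M))

end TemperedDiffusion

end

open Set

noncomputable section

/-! The bound is consistency plus stability, where stability is measured in a weight that
compensates the initial layer.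

Sign structure. The history recurrence is exact integration of an exponential against the piecewise
linear interpolant, so the sum over the exponentials is one convolution with the positive kernel
`soeKernel` (`sum_history`). Hence the fast derivative has a positive diagonal coefficient and
nonpositive off-diagonal ones, for every admissible approximation, and it obeys a comparison
principle (`fastCaputo_le_of_le`).

Stability. Compare with the barrier that is 0 at time 0 and e^{γ t_n} afterwards. The exact kernel
would give its fast derivative the lower bound t_n^{-α} e^{γ t_n} / Γ(1-α); the kernel error lowers
the factor t_n^{-α} by at most αε/γ, because the steps do not decrease and the exponential sums
geometrically. For γ large, in terms of ε₀ only, half of the bound survives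
(`le_fastCaputo_barrier`). At a space-time maximum of |error| e^{-γ t_n} the central difference has
the good sign, so the error is at most a constant times the maximum of t_n^α |residual|
(`abs_le_of_residual_le`).

Consistency. Integrating the Caputo integral by parts on [0, t_{n-1}] reproduces the boundary terms
of the scheme. What remains is a slope error on the newest interval and an interpolation and kernel
error in the history (`fastCaputo_sub_temperedCaputo`). With β = min(2-α, rα), the weak singularity
and the grading bound it by a constant times n^{-β} + ε (`exists_consistency`). This is not small
for small n, but t_n^α n^{-β} ≤ T^α N^{-β} (`meshTime_rpow_mul_le`), so the weight supplied by
stability restores the rate. The spatial residual is the usual h². -/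

namespace TemperedDiffusion

/-! ### The graded mesh -/

section Mesh

variable {T r : ℝ} {N : ℕ}

lemma meshTime_zero (hr : 1 ≤ r) : meshTime T r N 0 = 0 := by
  simp [meshTime, Real.zero_rpow (by linarith : r ≠ 0)]

lemma meshTime_pos (hT : 0 < T) (hN : 1 ≤ N) (n : ℕ) : 0 < meshTime T r N (n + 1) := by
  have : (0 : ℝ) < N := by exact_mod_cast hN
  unfold meshTime
  positivity

lemma meshTime_nonneg (hT : 0 < T) (n : ℕ) : 0 ≤ meshTime T r N n := by
  unfold meshTime
  positivity

lemma meshTime_mono (hT : 0 < T) (hr : 1 ≤ r) : Monotone (meshTime T r N) := by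
  intro a b hab
  unfold meshTime
  gcongr

lemma meshTime_strictMono (hT : 0 < T) (hr : 1 ≤ r) (hN : 1 ≤ N) :
    StrictMono (meshTime T r N) := by
  have : (0 : ℝ) < N := by exact_mod_cast hN
  intro a b hab
  unfold meshTime
  have : (a : ℝ) < b := by exact_mod_cast hab
  gcongr

lemma meshTime_le (hT : 0 < T) (hr : 1 ≤ r) {n : ℕ} (hn : n ≤ N) : meshTime T r N n ≤ T := by
  unfold meshTime
  have h : (n : ℝ) / N ≤ 1 := div_le_one_of_le₀ (by exact_mod_cast hn) (by positivity)
  have := Real.rpow_le_one (by positivity) h (by linarith : 0 ≤ r)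
  nlinarith

lemma meshStep_succ (n : ℕ) :
    meshStep T r N (n + 1) = meshTime T r N (n + 1) - meshTime T r N n := rfl

lemma meshStep_pos (hT : 0 < T) (hr : 1 ≤ r) (hN : 1 ≤ N) (n : ℕ) :
    0 < meshStep T r N (n + 1) :=
  sub_pos.2 (meshTime_strictMono hT hr hN n.lt_succ_self)

/-- Self-similarity of the mesh: relative to t_n, earlier times depend on m/n alone. This is why the
local estimates below contain n but not N. -/
lemma meshTime_eq_mul (m : ℕ) {n : ℕ} (hn : 1 ≤ n) :
    meshTime T r N m = meshTime T r N n * ((m : ℝ) / n) ^ r := by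
  have h : (0 : ℝ) < n := by exact_mod_cast hn
  unfold meshTime
  rw [mul_assoc, ← Real.mul_rpow (by positivity) (by positivity)]
  congr 2
  field_simp

/-- Bernoulli's inequality for (1 - 1/(n+1))^r. Together with `le_meshStep` it pins the step to the
size t_{n+1}/(n+1), up to the factor r. -/
lemma meshStep_le (hT : 0 < T) (hr : 1 ≤ r) (n : ℕ) :
    meshStep T r N (n + 1) ≤ r * meshTime T r N (n + 1) / (n + 1) := by
  rw [meshStep_succ, meshTime_eq_mul n (Nat.succ_le_succ (Nat.zero_le n))]
  have h := one_add_mul_self_le_rpow_one_add (s := -1 / ((n : ℝ) + 1))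
    (by rw [le_div_iff₀ (by positivity)]; have : (0 : ℝ) ≤ n := by positivity
        linarith) hr
  have e : 1 + -1 / ((n : ℝ) + 1) = (n : ℝ) / ((n + 1 : ℕ) : ℝ) := by
    push_cast; field_simp; ring
  rw [e] at h
  have h2 := mul_le_mul_of_nonneg_left h (meshTime_nonneg (T := T) (r := r) (N := N) hT (n + 1))
  have e2 : r * meshTime T r N (n + 1) / (n + 1) =
    meshTime T r N (n + 1) - meshTime T r N (n + 1) * (1 + r * (-1 / ((n : ℝ) + 1))) := by
    ring
  linarith

lemma le_meshStep (hT : 0 < T) (hr : 1 ≤ r) (n : ℕ) :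
    meshTime T r N (n + 1) / (n + 1) ≤ meshStep T r N (n + 1) := by
  rw [meshStep_succ, meshTime_eq_mul n (Nat.succ_le_succ (Nat.zero_le n))]
  have h : ((n : ℝ) / ((n + 1 : ℕ) : ℝ)) ^ r ≤ (n : ℝ) / ((n + 1 : ℕ) : ℝ) :=
    Real.rpow_le_self_of_le_one (by positivity)
      (div_le_one_of_le₀ (by push_cast; linarith) (by positivity)) hr
  have h2 := mul_le_mul_of_nonneg_left h (meshTime_nonneg (T := T) (r := r) (N := N) hT (n + 1))
  have e2 : meshTime T r N (n + 1) / (n + 1) =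
    meshTime T r N (n + 1) - meshTime T r N (n + 1) * ((n : ℝ) / ((n + 1 : ℕ) : ℝ)) := by
    push_cast; field_simp; ring
  linarith

/-- Midpoint convexity of x^r. The barrier estimate needs nondecreasing steps in order to sum the
kernel error. -/
lemma meshStep_le_meshStep_succ (hT : 0 < T) (hr : 1 ≤ r) (n : ℕ) :
    meshStep T r N (n + 1) ≤ meshStep T r N (n + 2) := by
  have h := (convexOn_rpow hr).2 (show (n : ℝ) / N ∈ Ici 0 from mem_Ici.2 (by positivity))
    (show ((n + 2 : ℕ) : ℝ) / N ∈ Ici 0 from mem_Ici.2 (by positivity))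
    (show (0 : ℝ) ≤ 1 / 2 by norm_num) (show (0 : ℝ) ≤ 1 / 2 by norm_num) (by norm_num)
  have e : (1 / 2 : ℝ) • ((n : ℝ) / N) + (1 / 2 : ℝ) • (((n + 2 : ℕ) : ℝ) / N) =
      ((n + 1 : ℕ) : ℝ) / N := by
    simp only [smul_eq_mul]; push_cast; ring
  rw [e] at h
  simp only [smul_eq_mul] at h
  have h3 := mul_le_mul_of_nonneg_left h hT.le
  rw [meshStep_succ, meshStep_succ]
  unfold meshTime
  linarith

lemma meshTime_succ_le (hT : 0 < T) (hr : 1 ≤ r) (n : ℕ) :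
    meshTime T r N (n + 2) ≤ 2 ^ r * meshTime T r N (n + 1) := by
  rw [meshTime_eq_mul (n + 2) (Nat.succ_le_succ (Nat.zero_le n)), mul_comm]
  gcongr
  · exact meshTime_nonneg hT _
  · rw [div_le_iff₀ (by positivity)]
    push_cast
    have : (0 : ℝ) ≤ n := by positivity
    linarith

lemma minStep_le {n : ℕ} (hn : n + 1 ≤ N) : minStep T r N ≤ meshStep T r N (n + 1) :=
  ciInf_le (Set.finite_range _).bddBelow (⟨n, hn⟩ : Fin N)

end Mesh

/-! ### The history as a convolution with the piecewise linear interpolant -/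

/-- The linear interpolant of the grid function `v` on `[t_k, t_{k+1}]`. -/
def interp (T r : ℝ) (N : ℕ) (v : ℕ → ℝ) (k : ℕ) (y : ℝ) : ℝ :=
  (v k * (meshTime T r N (k + 1) - y) + v (k + 1) * (y - meshTime T r N k)) /
    meshStep T r N (k + 1)

/-- The convolution at `t_{n+1}` of the kernel `κ` with the piecewise linear interpolant of `v`,
restricted to `[0, t_n]`. -/
def interpConv (T r : ℝ) (N : ℕ) (κ : ℝ → ℝ) (v : ℕ → ℝ) (n : ℕ) : ℝ :=
  ∑ k ∈ Finset.range n, ∫ y in meshTime T r N k..meshTime T r N (k + 1),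
    κ (meshTime T r N (n + 1) - y) * interp T r N v k y

lemma integral_exp_mul_linear {μ a b : ℝ} (hμ : μ ≠ 0) (hab : a < b) (p q : ℝ) :
    ∫ y in a..b, Real.exp (-μ * (b - y)) * ((p * (b - y) + q * (y - a)) / (b - a)) =
      1 / (μ ^ 2 * (b - a)) * ((Real.exp (-μ * (b - a)) - 1 + μ * (b - a)) * q +
        (1 - Real.exp (-μ * (b - a)) - Real.exp (-μ * (b - a)) * (μ * (b - a))) * p) := by
  have hd : b - a ≠ 0 := (sub_pos.2 hab).ne'
  have hder : ∀ y ∈ uIcc a b, HasDerivAt (fun y => Real.exp (-μ * (b - y)) *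
      ((p * (b - y) + q * (y - a)) / (μ * (b - a)) - (q - p) / (μ ^ 2 * (b - a))))
      (Real.exp (-μ * (b - y)) * ((p * (b - y) + q * (y - a)) / (b - a))) y := by
    intro y _
    have h1 : HasDerivAt (fun y => Real.exp (-μ * (b - y)))
        (Real.exp (-μ * (b - y)) * (-μ * -1)) y :=
      (((hasDerivAt_id y).const_sub b).const_mul (-μ)).exp
    have h2 : HasDerivAt (fun y => (p * (b - y) + q * (y - a)) / (μ * (b - a)) -
        (q - p) / (μ ^ 2 * (b - a))) ((p * -1 + q * 1) / (μ * (b - a))) y :=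
      (((((hasDerivAt_id y).const_sub b).const_mul p).add
        (((hasDerivAt_id y).sub_const a).const_mul q)).div_const _).sub_const _
    refine (h1.mul h2).congr_deriv ?_
    field_simp
    ring
  rw [intervalIntegral.integral_eq_sub_of_hasDerivAt hder]
  · simp only [sub_self, mul_zero, Real.exp_zero]
    field_simp
    ring
  · apply Continuous.intervalIntegrable
    fun_prop

lemma continuous_interp (T r : ℝ) (N : ℕ) (v : ℕ → ℝ) (k : ℕ) :
    Continuous (interp T r N v k) := by
  unfold interp
  fun_prop

/-- Moving the evaluation time from t_n to t_{n+1} multiplies the old integral by e^{-μτ}, and the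
bracket in the recurrence is the exact integral over the newest interval, by
`integral_exp_mul_linear`. So the recurrence makes no error beyond interpolation. -/
lemma history_succ {T r μ : ℝ} {N : ℕ} (hT : 0 < T) (hr : 1 ≤ r) (hN : 1 ≤ N) (hμ : μ ≠ 0)
    (v : ℕ → ℝ) (n : ℕ) :
    history T r N μ v (n + 1) = interpConv T r N (fun w => Real.exp (-μ * w)) v n := by
  induction n with
  | zero => simp [history, interpConv]
  | succ n ih =>
    rw [history, ih, interpConv, interpConv, Finset.sum_range_succ, Finset.mul_sum]
    have hexp : ∀ y, Real.exp (-μ * (meshTime T r N (n + 1 + 1) - y)) =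
        Real.exp (-μ * meshStep T r N (n + 2)) *
          Real.exp (-μ * (meshTime T r N (n + 1) - y)) := by
      intro y
      rw [← Real.exp_add, meshStep_succ]
      ring_nf
    congr 1
    · refine Finset.sum_congr rfl fun k _ => ?_
      rw [← intervalIntegral.integral_const_mul]
      refine intervalIntegral.integral_congr fun y _ => ?_
      simp only [hexp, mul_assoc]
    · have h := integral_exp_mul_linear hμ (meshTime_strictMono hT hr hN n.lt_succ_self)
        (v n) (v (n + 1))
      simp only [hexp, interp, mul_assoc, intervalIntegral.integral_const_mul]
      simp only [Nat.succ_eq_add_one] at h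
      rw [meshStep_succ n, h]
      ring

/-- The tempered sum-of-exponentials kernel. -/
def soeKernel (ρ : ℝ) {Q : ℕ} (ω s : Fin Q → ℝ) (w : ℝ) : ℝ :=
  Real.exp (-ρ * w) * ∑ i, ω i * Real.exp (-s i * w)

lemma continuous_soeKernel (ρ : ℝ) {Q : ℕ} (ω s : Fin Q → ℝ) : Continuous (soeKernel ρ ω s) := by
  unfold soeKernel
  fun_prop

lemma sum_history {T r ρ : ℝ} {N : ℕ} (hT : 0 < T) (hr : 1 ≤ r) (hN : 1 ≤ N) (hρ : 0 ≤ ρ)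
    {Q : ℕ} {ω s : Fin Q → ℝ} (hs : ∀ i, 0 < s i) (v : ℕ → ℝ) (n : ℕ) :
    ∑ i, ω i * history T r N (ρ + s i) v (n + 1) =
      interpConv T r N (soeKernel ρ ω s) v n := by
  have hi : ∀ i, history T r N (ρ + s i) v (n + 1) =
      interpConv T r N (fun w => Real.exp (-(ρ + s i) * w)) v n := fun i =>
    history_succ hT hr hN (by have := hs i; positivity) v n
  simp only [hi, interpConv, Finset.mul_sum]
  rw [Finset.sum_comm]
  refine Finset.sum_congr rfl fun k _ => ?_
  simp only [← intervalIntegral.integral_const_mul]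
  rw [← intervalIntegral.integral_finsetSum]
  · refine intervalIntegral.integral_congr fun y _ => ?_
    simp only [soeKernel, Finset.mul_sum, Finset.sum_mul]
    refine Finset.sum_congr rfl fun i _ => ?_
    rw [neg_add, add_mul, Real.exp_add]
    ring
  · intro i _
    apply Continuous.intervalIntegrable
    have := continuous_interp T r N v k
    fun_prop

lemma fastCaputo_succ {α ρ T r : ℝ} {N : ℕ} (hT : 0 < T) (hr : 1 ≤ r) (hN : 1 ≤ N) (hρ : 0 ≤ ρ)
    {Q : ℕ} {ω s : Fin Q → ℝ} (hs : ∀ i, 0 < s i) (v : ℕ → ℝ) (n : ℕ) :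
    fastCaputo α ρ T r N ω s v (n + 1) =
      (v (n + 1) - Real.exp (-ρ * meshStep T r N (n + 1)) * v n) /
        (meshStep T r N (n + 1) ^ α * Real.Gamma (2 - α)) +
      1 / Real.Gamma (1 - α) *
        (Real.exp (-ρ * meshStep T r N (n + 1)) * v n / meshStep T r N (n + 1) ^ α -
          Real.exp (-ρ * meshTime T r N (n + 1)) * v 0 / meshTime T r N (n + 1) ^ α -
          α * interpConv T r N (soeKernel ρ ω s) v n) := by
  rcases n with _ | n
  -- The first step fits the general formula: the history is empty and τ_1 = t_1, so the two
  -- boundary terms cancel.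
  · simp [fastCaputo, interpConv, meshStep, meshTime_zero hr]
  · rw [fastCaputo, if_neg (by omega), ← sum_history hT hr hN hρ hs]
    simp only [Nat.add_sub_cancel]
    congr 1
    have h1 : Real.exp (-ρ * meshStep T r N (n + 1 + 1)) =
        Real.exp (-ρ * meshTime T r N (n + 1 + 1)) * Real.exp (ρ * meshTime T r N (n + 1)) := by
      rw [← Real.exp_add, meshStep_succ]; ring_nf
    have h2 : ∑ i, ω i * Real.exp (ρ * meshTime T r N (n + 1 + 1)) *
        history T r N (ρ + s i) v (n + 1 + 1) = Real.exp (ρ * meshTime T r N (n + 1 + 1)) *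
          ∑ i, ω i * history T r N (ρ + s i) v (n + 1 + 1) := by
      rw [Finset.mul_sum]; exact Finset.sum_congr rfl fun i _ => by ring
    have h3 : Real.exp (-ρ * meshTime T r N (n + 1 + 1)) *
        Real.exp (ρ * meshTime T r N (n + 1 + 1)) = 1 := by
      rw [← Real.exp_add]; simp
    rw [h1, h2]
    linear_combination (-α / Real.Gamma (1 - α) *
      ∑ i, ω i * history T r N (ρ + s i) v (n + 1 + 1)) * h3

lemma interp_nonneg {T r : ℝ} {N : ℕ} (hT : 0 < T) (hr : 1 ≤ r) (hN : 1 ≤ N) {v : ℕ → ℝ} {k : ℕ}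
    (h0 : 0 ≤ v k) (h1 : 0 ≤ v (k + 1)) {y : ℝ}
    (hy : y ∈ Icc (meshTime T r N k) (meshTime T r N (k + 1))) : 0 ≤ interp T r N v k y :=
  div_nonneg (add_nonneg (mul_nonneg h0 (sub_nonneg.2 hy.2)) (mul_nonneg h1 (sub_nonneg.2 hy.1)))
    (meshStep_pos hT hr hN k).le

lemma interp_le {T r : ℝ} {N : ℕ} (hT : 0 < T) (hr : 1 ≤ r) (hN : 1 ≤ N) {v : ℕ → ℝ} {k : ℕ}
    {A : ℝ} (h0 : v k ≤ A) (h1 : v (k + 1) ≤ A) {y : ℝ}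
    (hy : y ∈ Icc (meshTime T r N k) (meshTime T r N (k + 1))) : interp T r N v k y ≤ A := by
  rw [interp, div_le_iff₀ (meshStep_pos hT hr hN k), meshStep_succ]
  nlinarith [hy.1, hy.2]

lemma interp_sub (T r : ℝ) (N : ℕ) (v w : ℕ → ℝ) (k : ℕ) (y : ℝ) :
    interp T r N (fun j => v j - w j) k y = interp T r N v k y - interp T r N w k y := by
  unfold interp
  ring

lemma interp_mul (T r : ℝ) (N : ℕ) (c : ℝ) (v : ℕ → ℝ) (k : ℕ) (y : ℝ) :
    interp T r N (fun j => c * v j) k y = c * interp T r N v k y := by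
  unfold interp
  ring

lemma interpConv_sub {T r : ℝ} {N : ℕ} {κ : ℝ → ℝ} (hκ : Continuous κ) (v w : ℕ → ℝ) (n : ℕ) :
    interpConv T r N κ (fun j => v j - w j) n =
      interpConv T r N κ v n - interpConv T r N κ w n := by
  simp only [interpConv, ← Finset.sum_sub_distrib]
  refine Finset.sum_congr rfl fun k _ => ?_
  rw [← intervalIntegral.integral_sub]
  · simp only [interp_sub, mul_sub]
  all_goals
    apply Continuous.intervalIntegrable
    have := continuous_interp T r N v k
    have := continuous_interp T r N w k
    fun_prop

lemma interpConv_mul (T r : ℝ) (N : ℕ) (κ : ℝ → ℝ) (c : ℝ) (v : ℕ → ℝ) (n : ℕ) :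
    interpConv T r N κ (fun j => c * v j) n = c * interpConv T r N κ v n := by
  simp only [interpConv, Finset.mul_sum]
  refine Finset.sum_congr rfl fun k _ => ?_
  rw [← intervalIntegral.integral_const_mul]
  refine intervalIntegral.integral_congr fun y _ => ?_
  simp only [interp_mul]
  ring

lemma interpConv_nonneg {T r : ℝ} {N : ℕ} (hT : 0 < T) (hr : 1 ≤ r) (hN : 1 ≤ N) {κ : ℝ → ℝ}
    (hκ : ∀ w, 0 ≤ κ w) {v : ℕ → ℝ} {n : ℕ} (hv : ∀ k ≤ n, 0 ≤ v k) :
    0 ≤ interpConv T r N κ v n := by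
  refine Finset.sum_nonneg fun k hk => ?_
  rw [Finset.mem_range] at hk
  refine intervalIntegral.integral_nonneg (meshTime_mono hT hr k.le_succ) fun y hy => ?_
  exact mul_nonneg (hκ _) (interp_nonneg hT hr hN (hv k hk.le) (hv (k + 1) hk) hy)

/-! ### Sign structure and comparison for the fast derivative -/

section fast

variable {α ρ T r : ℝ} {N Q : ℕ} {ω s : Fin Q → ℝ}

lemma soeKernel_nonneg (hω : ∀ i, 0 < ω i) (w : ℝ) : 0 ≤ soeKernel ρ ω s w :=
  mul_nonneg (Real.exp_pos _).le
    (Finset.sum_nonneg fun i _ => mul_nonneg (hω i).le (Real.exp_pos _).le)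

lemma abs_sub_soeKernel_le {ε : ℝ} (hρ : 0 ≤ ρ) {σ : ℝ} (h : IsSOE (1 + α) σ T ε ω s) {w : ℝ}
    (hw0 : 0 ≤ w) (hw : w ∈ Icc σ T) :
    |Real.exp (-ρ * w) * w ^ (-(1 + α)) - soeKernel ρ ω s w| ≤ ε := by
  rw [soeKernel, ← mul_sub, abs_mul, abs_of_pos (Real.exp_pos _)]
  have h1 : Real.exp (-ρ * w) ≤ 1 := by
    rw [Real.exp_le_one_iff]
    nlinarith
  exact (mul_le_of_le_one_left (abs_nonneg _) h1).trans (h.approx w hw)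

lemma one_div_Gamma (hα1 : α < 1) :
    1 / Real.Gamma (2 - α) = 1 / Real.Gamma (1 - α) * (1 / (1 - α)) := by
  have h : Real.Gamma (2 - α) = (1 - α) * Real.Gamma (1 - α) := by
    rw [← Real.Gamma_add_one (by linarith)]
    ring_nf
  rw [h, one_div, one_div, one_div, mul_inv, mul_comm]

/-- The two contributions of the previous value merge through 1/(1-α) - 1 = α/(1-α), which makes
every sign visible: all values but the newest enter negatively. Linearity and comparison are read
off from this form. -/
lemma fastCaputo_succ' (hα1 : α < 1) (hT : 0 < T) (hr : 1 ≤ r) (hN : 1 ≤ N) (hρ : 0 ≤ ρ)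
    (hs : ∀ i, 0 < s i) (v : ℕ → ℝ) (n : ℕ) :
    fastCaputo α ρ T r N ω s v (n + 1) =
      1 / Real.Gamma (1 - α) * ((v (n + 1) * (1 / (1 - α)) -
          Real.exp (-ρ * meshStep T r N (n + 1)) * v n * (α / (1 - α))) *
            (meshStep T r N (n + 1) ^ α)⁻¹ -
          Real.exp (-ρ * meshTime T r N (n + 1)) * v 0 * (meshTime T r N (n + 1) ^ α)⁻¹ -
          α * interpConv T r N (soeKernel ρ ω s) v n) := by
  have h1 : 1 - α ≠ 0 := by linarith
  rw [fastCaputo_succ hT hr hN hρ hs, mul_comm (_ ^ α) (Real.Gamma (2 - α)), ← div_div,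
    div_eq_mul_one_div _ (Real.Gamma (2 - α)), one_div_Gamma hα1]
  simp only [div_eq_mul_inv]
  have : (1 - α)⁻¹ - 1 = α * (1 - α)⁻¹ := by field_simp; ring
  rw [← this]
  ring

lemma fastCaputo_sub (hα1 : α < 1) (hT : 0 < T) (hr : 1 ≤ r) (hN : 1 ≤ N) (hρ : 0 ≤ ρ)
    (hs : ∀ i, 0 < s i) (v w : ℕ → ℝ) (n : ℕ) :
    fastCaputo α ρ T r N ω s (fun j => v j - w j) (n + 1) =
      fastCaputo α ρ T r N ω s v (n + 1) - fastCaputo α ρ T r N ω s w (n + 1) := by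
  simp only [fastCaputo_succ' hα1 hT hr hN hρ hs, interpConv_sub (continuous_soeKernel ρ ω s)]
  ring

lemma fastCaputo_mul (hα1 : α < 1) (hT : 0 < T) (hr : 1 ≤ r) (hN : 1 ≤ N) (hρ : 0 ≤ ρ)
    (hs : ∀ i, 0 < s i) (c : ℝ) (v : ℕ → ℝ) (n : ℕ) :
    fastCaputo α ρ T r N ω s (fun j => c * v j) (n + 1) =
      c * fastCaputo α ρ T r N ω s v (n + 1) := by
  simp only [fastCaputo_succ' hα1 hT hr hN hρ hs, interpConv_mul]
  ring

/-- The off-diagonal coefficients of the fast discrete derivative are nonpositive. -/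
lemma fastCaputo_nonpos (hα0 : 0 < α) (hα1 : α < 1) (hT : 0 < T) (hr : 1 ≤ r) (hN : 1 ≤ N)
    (hρ : 0 ≤ ρ) (hs : ∀ i, 0 < s i) (hω : ∀ i, 0 < ω i) {v : ℕ → ℝ} {n : ℕ}
    (hv : ∀ k ≤ n, 0 ≤ v k) (hn : v (n + 1) = 0) :
    fastCaputo α ρ T r N ω s v (n + 1) ≤ 0 := by
  rw [fastCaputo_succ' hα1 hT hr hN hρ hs, hn]
  have hΓ : 0 < Real.Gamma (1 - α) := Real.Gamma_pos_of_pos (by linarith)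
  have h1 := interpConv_nonneg hT hr hN (soeKernel_nonneg (ρ := ρ) (s := s) hω) hv
  have h2 : 0 ≤ Real.exp (-ρ * meshTime T r N (n + 1)) * v 0 * (meshTime T r N (n + 1) ^ α)⁻¹ :=
    mul_nonneg (mul_nonneg (Real.exp_pos _).le (hv 0 n.zero_le))
      (inv_nonneg.2 (Real.rpow_nonneg (meshTime_nonneg hT _) _))
  have h3 : 0 ≤ Real.exp (-ρ * meshStep T r N (n + 1)) * v n * (α / (1 - α)) *
      (meshStep T r N (n + 1) ^ α)⁻¹ :=
    mul_nonneg (mul_nonneg (mul_nonneg (Real.exp_pos _).le (hv n le_rfl))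
      (div_nonneg hα0.le (by linarith)))
      (inv_nonneg.2 (Real.rpow_nonneg (meshStep_pos hT hr hN _).le _))
  refine mul_nonpos_of_nonneg_of_nonpos (by positivity) ?_
  nlinarith

lemma fastCaputo_le_of_le (hα0 : 0 < α) (hα1 : α < 1) (hT : 0 < T) (hr : 1 ≤ r) (hN : 1 ≤ N)
    (hρ : 0 ≤ ρ) (hs : ∀ i, 0 < s i) (hω : ∀ i, 0 < ω i) {v w : ℕ → ℝ} {n : ℕ}
    (hv : ∀ k ≤ n, v k ≤ w k) (hn : v (n + 1) = w (n + 1)) :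
    fastCaputo α ρ T r N ω s w (n + 1) ≤ fastCaputo α ρ T r N ω s v (n + 1) := by
  have h := fastCaputo_nonpos hα0 hα1 hT hr hN hρ hs hω (v := fun j => w j - v j) (n := n)
    (fun k hk => sub_nonneg.2 (hv k hk)) (by simp [hn])
  rw [fastCaputo_sub hα1 hT hr hN hρ hs] at h
  linarith

end fast

/-! ### The exponential barrier -/

lemma integral_kernel {α a b c : ℝ} (hα0 : 0 < α) (hab : a ≤ b) (hbc : b < c) :
    ∫ y in a..b, (c - y) ^ (-(1 + α)) = ((c - b) ^ (-α) - (c - a) ^ (-α)) / α := by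
  rw [intervalIntegral.integral_comp_sub_left (fun w => w ^ (-(1 + α))),
    integral_rpow (Or.inr ⟨by linarith, ?_⟩)]
  · rw [show -(1 + α) + 1 = -α by ring, div_neg, ← neg_div]
    ring
  · rw [uIcc_of_le (by linarith)]
    exact fun h => absurd h.1 (by linarith)

lemma intervalIntegrable_kernel {α a b c : ℝ} (hab : a ≤ b) (hbc : b < c) :
    IntervalIntegrable (fun y => (c - y) ^ (-(1 + α))) MeasureTheory.volume a b := by
  apply ContinuousOn.intervalIntegrable
  rw [uIcc_of_le hab]
  refine ContinuousOn.rpow_const (by fun_prop) fun y hy => Or.inl ?_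
  have := hy.2
  linarith

/-- The exponential barrier: zero at the initial time, `e^{γ t_k}` for `k ≥ 1`. -/
def barrier (T r : ℝ) (N : ℕ) (γ : ℝ) (k : ℕ) : ℝ :=
  if k = 0 then 0 else Real.exp (γ * meshTime T r N k)

lemma barrier_nonneg (T r : ℝ) (N : ℕ) (γ : ℝ) (k : ℕ) : 0 ≤ barrier T r N γ k := by
  unfold barrier
  split_ifs
  exacts [le_rfl, (Real.exp_pos _).le]

lemma barrier_mono {T r : ℝ} {N : ℕ} {γ : ℝ} (hT : 0 < T) (hr : 1 ≤ r) (hγ : 0 ≤ γ) :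
    Monotone (barrier T r N γ) := by
  intro a b hab
  rcases Nat.eq_zero_or_pos a with rfl | ha
  · simpa [barrier] using barrier_nonneg T r N γ b
  · rw [barrier, barrier, if_neg (by omega), if_neg (by omega)]
    have := meshTime_mono (N := N) hT hr hab
    gcongr

/-- A right-endpoint sum overestimates the integral of an increasing function, so the left side
cannot be compared with ∫ e^{γt} directly. Replacing each step by the next, larger one turns it into
a left-endpoint sum, which telescopes because γτ ≤ e^{γτ} - 1. -/
lemma sum_meshStep_mul_barrier_le {T r : ℝ} {N : ℕ} {γ : ℝ} (hT : 0 < T) (hr : 1 ≤ r)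
    (hγ : 0 < γ) (n : ℕ) :
    ∑ k ∈ Finset.range n, meshStep T r N (k + 1) * barrier T r N γ (k + 1) ≤
      barrier T r N γ (n + 1) / γ := by
  induction n with
  | zero => simpa using div_nonneg (barrier_nonneg T r N γ 1) hγ.le
  | succ n ih =>
    rw [Finset.sum_range_succ]
    have h1 : meshStep T r N (n + 1) * barrier T r N γ (n + 1) ≤
        (barrier T r N γ (n + 2) - barrier T r N γ (n + 1)) / γ := by
      rw [le_div_iff₀ hγ]
      have e : barrier T r N γ (n + 2) =
          barrier T r N γ (n + 1) * Real.exp (γ * meshStep T r N (n + 2)) := by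
        rw [barrier, barrier, if_neg (by omega), if_neg (by omega), ← Real.exp_add, meshStep_succ]
        ring_nf
      rw [e]
      have h2 := Real.add_one_le_exp (γ * meshStep T r N (n + 2))
      have h3 := mul_le_mul_of_nonneg_left (meshStep_le_meshStep_succ (N := N) hT hr n) hγ.le
      have h4 := mul_le_mul_of_nonneg_left (h3.trans (by linarith :
        γ * meshStep T r N (n + 2) ≤ Real.exp (γ * meshStep T r N (n + 2)) - 1))
        (barrier_nonneg T r N γ (n + 1))
      linarith
    have : barrier T r N γ (n + 1 + 1) / γ = barrier T r N γ (n + 1) / γ +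
      (barrier T r N γ (n + 2) - barrier T r N γ (n + 1)) / γ := by ring
    linarith

/-- The history stops one step before the evaluation time, so the kernel is only sampled where the
sum of exponentials is accurate. -/
lemma mem_Icc_minStep {T r : ℝ} {N : ℕ} (hT : 0 < T) (hr : 1 ≤ r) {n : ℕ} (hn : n + 1 ≤ N) {y : ℝ}
    (hy : y ∈ Icc 0 (meshTime T r N n)) :
    meshTime T r N (n + 1) - y ∈ Icc (minStep T r N) T := by
  have h1 := minStep_le (T := T) (r := r) hn
  have h2 := meshTime_le hT hr hn
  rw [meshStep_succ] at h1
  exact ⟨by linarith [hy.2], by linarith [hy.1]⟩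

lemma sum_integral_kernel {α T r : ℝ} {N : ℕ} (hα0 : 0 < α) (hT : 0 < T) (hr : 1 ≤ r) (hN : 1 ≤ N)
    (n : ℕ) :
    ∑ k ∈ Finset.range n, ∫ y in meshTime T r N k..meshTime T r N (k + 1),
      (meshTime T r N (n + 1) - y) ^ (-(1 + α)) =
      (meshStep T r N (n + 1) ^ (-α) - meshTime T r N (n + 1) ^ (-α)) / α := by
  have hn := meshTime_strictMono hT hr hN n.lt_succ_self
  rw [intervalIntegral.sum_integral_adjacent_intervals, meshTime_zero hr,
    integral_kernel hα0 (meshTime_nonneg hT n) hn, meshStep_succ, sub_zero]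
  intro k hk
  exact intervalIntegrable_kernel (meshTime_mono hT hr k.le_succ)
    ((meshTime_mono hT hr hk).trans_lt hn)

lemma interpConv_barrier_le {α ρ T r γ ε : ℝ} {N Q : ℕ} {ω s : Fin Q → ℝ} (hα0 : 0 < α)
    (hT : 0 < T) (hr : 1 ≤ r) (hN : 1 ≤ N) (hρ : 0 ≤ ρ) (hγ : 0 < γ) (hε : 0 < ε)
    (h : IsSOE (1 + α) (minStep T r N) T ε ω s) {n : ℕ} (hn : n + 1 ≤ N) :
    interpConv T r N (soeKernel ρ ω s) (barrier T r N γ) n ≤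
      barrier T r N γ (n + 1) *
        ((meshStep T r N (n + 1) ^ (-α) - meshTime T r N (n + 1) ^ (-α)) / α + ε / γ) := by
  have htn := meshTime_strictMono hT hr hN n.lt_succ_self
  have hterm : ∀ k ∈ Finset.range n, ∫ y in meshTime T r N k..meshTime T r N (k + 1),
      soeKernel ρ ω s (meshTime T r N (n + 1) - y) * interp T r N (barrier T r N γ) k y ≤
      barrier T r N γ (n + 1) * (∫ y in meshTime T r N k..meshTime T r N (k + 1),
        (meshTime T r N (n + 1) - y) ^ (-(1 + α))) +
      ε * (meshStep T r N (k + 1) * barrier T r N γ (k + 1)) := by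
    intro k hk
    rw [Finset.mem_range] at hk
    have hkn := meshTime_mono (N := N) hT hr hk
    have hint := intervalIntegrable_kernel (α := α) (meshTime_mono (N := N) hT hr k.le_succ)
      (hkn.trans_lt htn)
    have e : barrier T r N γ (n + 1) * (∫ y in meshTime T r N k..meshTime T r N (k + 1),
        (meshTime T r N (n + 1) - y) ^ (-(1 + α))) +
        ε * (meshStep T r N (k + 1) * barrier T r N γ (k + 1)) =
        ∫ y in meshTime T r N k..meshTime T r N (k + 1), (barrier T r N γ (n + 1) *
          (meshTime T r N (n + 1) - y) ^ (-(1 + α)) + ε * barrier T r N γ (k + 1)) := by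
      rw [intervalIntegral.integral_add (hint.const_mul _) (by simp),
        intervalIntegral.integral_const_mul, intervalIntegral.integral_const, meshStep_succ,
        smul_eq_mul]
      ring
    rw [e]
    refine intervalIntegral.integral_mono_on (meshTime_mono hT hr k.le_succ) ?_
      ((hint.const_mul _).add (by simp)) fun y hy => ?_
    · apply Continuous.intervalIntegrable
      have := continuous_interp T r N (barrier T r N γ) k
      have := continuous_soeKernel ρ ω s
      fun_prop
    · have hy0 : 0 ≤ y := (meshTime_nonneg hT k).trans hy.1
      have hw := mem_Icc_minStep hT hr hn ⟨hy0, hy.2.trans hkn⟩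
      have hw0 : 0 ≤ meshTime T r N (n + 1) - y := by linarith [hy.2]
      have h1 := (abs_le.1 (abs_sub_soeKernel_le hρ h hw0 hw)).1
      have hpow : 0 ≤ (meshTime T r N (n + 1) - y) ^ (-(1 + α)) := Real.rpow_nonneg hw0 _
      have h2 : Real.exp (-ρ * (meshTime T r N (n + 1) - y)) *
          (meshTime T r N (n + 1) - y) ^ (-(1 + α)) ≤
          (meshTime T r N (n + 1) - y) ^ (-(1 + α)) := by
        refine mul_le_of_le_one_left hpow ?_
        rw [Real.exp_le_one_iff]
        nlinarith
      have hb0 := barrier_nonneg T r N γ (k + 1)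
      have h3 := interp_le hT hr hN (v := barrier T r N γ)
        (barrier_mono hT hr hγ.le k.le_succ) le_rfl hy
      have h4 := interp_nonneg hT hr hN (barrier_nonneg T r N γ k) hb0 hy
      -- Only the singular part is enlarged to b_{n+1}. The ε part keeps b_{k+1}, so that its sum is
      -- b_{n+1}/γ and not T b_{n+1}.
      have h5 := barrier_mono (N := N) hT hr hγ.le (show k + 1 ≤ n + 1 by omega)
      calc _ ≤ ((meshTime T r N (n + 1) - y) ^ (-(1 + α)) + ε) *
            interp T r N (barrier T r N γ) k y :=
            mul_le_mul_of_nonneg_right (by linarith) h4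
        _ ≤ ((meshTime T r N (n + 1) - y) ^ (-(1 + α)) + ε) * barrier T r N γ (k + 1) :=
            mul_le_mul_of_nonneg_left h3 (by linarith)
        _ ≤ _ := by nlinarith
  refine (Finset.sum_le_sum hterm).trans ?_
  rw [Finset.sum_add_distrib, ← Finset.mul_sum, ← Finset.mul_sum,
    sum_integral_kernel hα0 hT hr hN]
  have := mul_le_mul_of_nonneg_left (sum_meshStep_mul_barrier_le (N := N) hT hr hγ n) hε.le
  rw [mul_add]
  have e : ε * (barrier T r N γ (n + 1) / γ) = barrier T r N γ (n + 1) * (ε / γ) := by ring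
  linarith

/-- The local part contributes at least b τ^{-α} and the history removes at most b (τ^{-α} - t^{-α}
+ αε/γ), where b is the newest value. The surplus b t^{-α} survives because the barrier vanishes at
time 0: the term with the initial value would otherwise consume it. Half of it pays for the kernel
error. -/
lemma le_fastCaputo_barrier {α ρ T r γ ε : ℝ} {N Q : ℕ} {ω s : Fin Q → ℝ} (hα0 : 0 < α)
    (hα1 : α < 1) (hT : 0 < T) (hr : 1 ≤ r) (hN : 1 ≤ N) (hρ : 0 ≤ ρ) (hγ : 0 < γ) (hε : 0 < ε)
    (h : IsSOE (1 + α) (minStep T r N) T ε ω s) {n : ℕ} (hn : n + 1 ≤ N)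
    (hεγ : α * (ε / γ) ≤ T ^ (-α) / 2) :
    1 / Real.Gamma (1 - α) * (meshTime T r N (n + 1) ^ (-α) / 2) ≤
      fastCaputo α ρ T r N ω s (barrier T r N γ) (n + 1) := by
  rw [fastCaputo_succ' hα1 hT hr hN hρ h.node_pos]
  have hΓ : 0 < Real.Gamma (1 - α) := Real.Gamma_pos_of_pos (by linarith)
  refine mul_le_mul_of_nonneg_left ?_ (by positivity)
  have ht := meshTime_pos (r := r) hT hN n
  have hτ := meshStep_pos hT hr hN n
  have h1 := interpConv_barrier_le hα0 hT hr hN hρ hγ hε h hn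
  have h2 : T ^ (-α) ≤ meshTime T r N (n + 1) ^ (-α) :=
    Real.rpow_le_rpow_of_nonpos ht (meshTime_le hT hr hn) (by linarith)
  have hb : 1 ≤ barrier T r N γ (n + 1) := by
    rw [barrier, if_neg (by omega)]
    exact Real.one_le_exp (by positivity)
  have h3 : barrier T r N γ (n + 1) * (meshStep T r N (n + 1) ^ (-α)) ≤
      (barrier T r N γ (n + 1) * (1 / (1 - α)) -
          Real.exp (-ρ * meshStep T r N (n + 1)) * barrier T r N γ n * (α / (1 - α))) *
            (meshStep T r N (n + 1) ^ α)⁻¹ := by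
    rw [Real.rpow_neg hτ.le]
    refine mul_le_mul_of_nonneg_right ?_ (by positivity)
    have h4 : Real.exp (-ρ * meshStep T r N (n + 1)) * barrier T r N γ n ≤
        barrier T r N γ (n + 1) := by
      refine (mul_le_of_le_one_left (barrier_nonneg _ _ _ _ _) ?_).trans
        (barrier_mono hT hr hγ.le n.le_succ)
      rw [Real.exp_le_one_iff]
      nlinarith
    have h5 := mul_le_mul_of_nonneg_right h4 (div_nonneg hα0.le (by linarith : 0 ≤ 1 - α))
    have e : barrier T r N γ (n + 1) = barrier T r N γ (n + 1) * (1 / (1 - α)) -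
        barrier T r N γ (n + 1) * (α / (1 - α)) := by
      have : 1 - α ≠ 0 := by linarith
      field_simp
    linarith
  have h0 : barrier T r N γ 0 = 0 := by simp [barrier]
  have h6 := mul_le_mul_of_nonneg_left h1 hα0.le
  have e6 : α * (barrier T r N γ (n + 1) *
        ((meshStep T r N (n + 1) ^ (-α) - meshTime T r N (n + 1) ^ (-α)) / α + ε / γ)) =
      barrier T r N γ (n + 1) *
        (meshStep T r N (n + 1) ^ (-α) - meshTime T r N (n + 1) ^ (-α) + α * (ε / γ)) := by
    field_simp
  rw [e6] at h6
  rw [h0]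
  have h7 : 0 ≤ meshTime T r N (n + 1) ^ (-α) := by positivity
  nlinarith

/-! ### Weakly singular functions of time -/

/-- `v` is twice differentiable on `(0,T)` with derivatives bounded by `A t^{α-1}`, `A t^{α-2}`. -/
structure WeaklySingular (α T A : ℝ) (v : ℝ → ℝ) : Prop where
  cont : ContinuousOn v (Icc 0 T)
  diff : ∀ t ∈ Ioo 0 T, HasDerivAt v (deriv v t) t
  diff_deriv : ∀ t ∈ Ioo 0 T, HasDerivAt (deriv v) (deriv (deriv v) t) t
  bound : ∀ t ∈ Icc 0 T, |v t| ≤ A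
  bound_deriv : ∀ t ∈ Ioo 0 T, |deriv v t| ≤ A * t ^ (α - 1)
  bound_deriv₂ : ∀ t ∈ Ioo 0 T, |deriv (deriv v) t| ≤ A * t ^ (α - 2)

/-- The factor by which multiplication with `e^{ρ t}` enlarges the weak singularity constant. -/
def expFactor (α ρ T : ℝ) : ℝ :=
  Real.exp (ρ * T) * (1 + 2 * ρ * T + ρ * T ^ (1 - α) + ρ ^ 2 * T ^ (2 - α))

namespace WeaklySingular

variable {α T A : ℝ} {v : ℝ → ℝ}

lemma nonneg (hT : 0 < T) (h : WeaklySingular α T A v) : 0 ≤ A :=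
  (abs_nonneg _).trans (h.bound 0 ⟨le_rfl, hT.le⟩)

lemma exp_mul {ρ : ℝ} (hα1 : α < 1) (hT : 0 < T) (hρ : 0 ≤ ρ) (h : WeaklySingular α T A v) :
    WeaklySingular α T (expFactor α ρ T * A) (fun y => Real.exp (ρ * y) * v y) := by
  have hA := h.nonneg hT
  have hexp : ∀ t, HasDerivAt (fun y => Real.exp (ρ * y)) (Real.exp (ρ * t) * ρ) t := fun t => by
    simpa using ((hasDerivAt_id t).const_mul ρ).exp
  have hd1 : ∀ t ∈ Ioo 0 T, HasDerivAt (fun y => Real.exp (ρ * y) * v y)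
      (Real.exp (ρ * t) * (deriv v t + ρ * v t)) t := fun t ht =>
    ((hexp t).mul (h.diff t ht)).congr_deriv (by ring)
  have hd2 : ∀ t ∈ Ioo 0 T, HasDerivAt (deriv (fun y => Real.exp (ρ * y) * v y))
      (Real.exp (ρ * t) * (deriv (deriv v) t + 2 * ρ * deriv v t + ρ ^ 2 * v t)) t := by
    intro t ht
    have h1 : HasDerivAt (fun y => Real.exp (ρ * y) * (deriv v y + ρ * v y))
        (Real.exp (ρ * t) * (deriv (deriv v) t + 2 * ρ * deriv v t + ρ ^ 2 * v t)) t :=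
      ((hexp t).mul ((h.diff_deriv t ht).add ((h.diff t ht).const_mul ρ))).congr_deriv (by
        simp only [Pi.add_apply]; ring)
    refine h1.congr_of_eventuallyEq ?_
    filter_upwards [isOpen_Ioo.mem_nhds ht] with y hy using (hd1 y hy).deriv
  have hE : ∀ t ∈ Icc 0 T, Real.exp (ρ * t) ≤ Real.exp (ρ * T) := fun t ht =>
    Real.exp_le_exp.2 (mul_le_mul_of_nonneg_left ht.2 hρ)
  have hp1 : 0 ≤ T ^ (1 - α) := by positivity
  have hp2 : 0 ≤ T ^ (2 - α) := by positivity
  have hρT : 0 ≤ ρ * T := by positivity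
  refine ⟨(by fun_prop : Continuous fun y => Real.exp (ρ * y)).continuousOn.mul h.cont,
    fun t ht => (hd1 t ht).differentiableAt.hasDerivAt,
    fun t ht => (hd2 t ht).differentiableAt.hasDerivAt, fun t ht => ?_, fun t ht => ?_,
    fun t ht => ?_⟩
  · rw [abs_mul, abs_of_pos (Real.exp_pos _), expFactor, mul_assoc]
    refine mul_le_mul (hE t ht) ((h.bound t ht).trans (le_mul_of_one_le_left hA ?_))
      (abs_nonneg _) (Real.exp_pos _).le
    nlinarith [mul_nonneg hρ hp1, mul_nonneg (sq_nonneg ρ) hp2]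
  · rw [(hd1 t ht).deriv, abs_mul, abs_of_pos (Real.exp_pos _), expFactor, mul_assoc (Real.exp (ρ * T)),
      mul_assoc (Real.exp (ρ * T))]
    refine mul_le_mul (hE t ⟨ht.1.le, ht.2.le⟩) ?_ (abs_nonneg _) (Real.exp_pos _).le
    have h1 := h.bound_deriv t ht
    have h2 := h.bound t ⟨ht.1.le, ht.2.le⟩
    -- Terms without a singularity are absorbed into the singular bound, at the price of a power of
    -- T. This produces the powers in `expFactor`.
    have h3 : 1 ≤ T ^ (1 - α) * t ^ (α - 1) := by
      have := Real.rpow_le_rpow_of_nonpos ht.1 ht.2.le (by linarith : α - 1 ≤ 0)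
      calc (1 : ℝ) = T ^ (1 - α) * T ^ (α - 1) := by
            rw [← Real.rpow_add hT]; simp
        _ ≤ _ := by gcongr
    have h4 : 0 ≤ A * t ^ (α - 1) := (abs_nonneg _).trans h1
    have h5 : |deriv v t + ρ * v t| ≤ A * t ^ (α - 1) + ρ * A := by
      refine (abs_add_le _ _).trans (add_le_add h1 ?_)
      rw [abs_mul, abs_of_nonneg hρ]
      gcongr
    have h6 := mul_le_mul_of_nonneg_left h3 (mul_nonneg hρ hA)
    nlinarith [mul_nonneg hρT h4, mul_nonneg (mul_nonneg (sq_nonneg ρ) hp2) h4]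
  · rw [(hd2 t ht).deriv, abs_mul, abs_of_pos (Real.exp_pos _), expFactor, mul_assoc (Real.exp (ρ * T)),
      mul_assoc (Real.exp (ρ * T))]
    refine mul_le_mul (hE t ⟨ht.1.le, ht.2.le⟩) ?_ (abs_nonneg _) (Real.exp_pos _).le
    have h0 := h.bound_deriv₂ t ht
    have h1 := h.bound_deriv t ht
    have h2 := h.bound t ⟨ht.1.le, ht.2.le⟩
    have h3 : 1 ≤ T ^ (2 - α) * t ^ (α - 2) := by
      have := Real.rpow_le_rpow_of_nonpos ht.1 ht.2.le (by linarith : α - 2 ≤ 0)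
      calc (1 : ℝ) = T ^ (2 - α) * T ^ (α - 2) := by
            rw [← Real.rpow_add hT]; simp
        _ ≤ _ := by gcongr
    have h7 : t ^ (α - 1) ≤ T * t ^ (α - 2) := by
      rw [show α - 1 = 1 + (α - 2) by ring, Real.rpow_add ht.1, Real.rpow_one]
      have := Real.rpow_nonneg ht.1.le (α - 2)
      nlinarith [ht.2]
    have h4 : 0 ≤ A * t ^ (α - 2) := (abs_nonneg _).trans h0
    have h5 : |deriv (deriv v) t + 2 * ρ * deriv v t + ρ ^ 2 * v t| ≤
        A * t ^ (α - 2) + 2 * ρ * (A * t ^ (α - 1)) + ρ ^ 2 * A := by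
      refine (abs_add_le _ _).trans (add_le_add ((abs_add_le _ _).trans (add_le_add h0 ?_)) ?_)
      · rw [abs_mul, abs_of_nonneg (by positivity)]
        gcongr
      · rw [abs_mul, abs_of_nonneg (by positivity)]
        gcongr
    have h6 := mul_le_mul_of_nonneg_left h3 (mul_nonneg (sq_nonneg ρ) hA)
    have h8 := mul_le_mul_of_nonneg_left h7 (mul_nonneg hρ hA)
    nlinarith [mul_nonneg (mul_nonneg hρ hp1) h4]

lemma abs_sub_le (hα0 : 0 < α) (h : WeaklySingular α T A v) {a b : ℝ} (ha : 0 ≤ a)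
    (hab : a ≤ b) (hb : b ≤ T) : |v b - v a| ≤ A / α * (b ^ α - a ^ α) := by
  have hpow : ∀ t ∈ Ioo 0 T, HasDerivAt (fun t => A / α * t ^ α) (A * t ^ (α - 1)) t := by
    intro t ht
    refine ((Real.hasDerivAt_rpow_const (p := α) (Or.inl ht.1.ne')).const_mul
      (A / α)).congr_deriv ?_
    field_simp
  have hc : ContinuousOn (fun t => A / α * t ^ α) (Icc 0 T) :=
    (continuousOn_id.rpow_const fun _ _ => Or.inr hα0.le).const_smul (A / α)
  -- The derivative may blow up at 0, so instead of a Lipschitz bound the function ±v is added to a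
  -- primitive of its majorant A t^{α-1}, and the sum is monotone.
  have key : ∀ c : ℝ, |c| ≤ 1 → MonotoneOn (fun t => A / α * t ^ α + c * v t) (Icc 0 T) := by
    intro c hc1
    have hd : ∀ t ∈ Ioo 0 T, HasDerivAt (fun t => A / α * t ^ α + c * v t)
        (A * t ^ (α - 1) + c * deriv v t) t := fun t ht =>
      (hpow t ht).add ((h.diff t ht).const_mul c)
    refine monotoneOn_of_deriv_nonneg (convex_Icc 0 T) (hc.add (h.cont.const_smul c)) ?_ ?_
    · rw [interior_Icc]
      exact fun t ht => (hd t ht).differentiableAt.differentiableWithinAt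
    · rw [interior_Icc]
      intro t ht
      rw [(hd t ht).deriv]
      have h1 := h.bound_deriv t ht
      have h2 : |c * deriv v t| ≤ |deriv v t| := by
        rw [abs_mul]
        exact mul_le_of_le_one_left (abs_nonneg _) hc1
      linarith [neg_abs_le (c * deriv v t)]
  have m1 := key 1 (by simp) ⟨ha, hab.trans hb⟩ ⟨ha.trans hab, hb⟩ hab
  have m2 := key (-1) (by simp) ⟨ha, hab.trans hb⟩ ⟨ha.trans hab, hb⟩ hab
  rw [abs_le]
  simp only at m1 m2
  constructor <;> linarith

lemma abs_deriv_sub_le (hα1 : α < 1) (hA : 0 ≤ A) (h : WeaklySingular α T A v) {a x y : ℝ}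
    (ha : 0 < a) (hx : x ∈ Ico a T) (hy : y ∈ Ico a T) :
    |deriv v y - deriv v x| ≤ A * a ^ (α - 2) * |y - x| := by
  refine Convex.norm_image_sub_le_of_norm_hasDerivWithin_le (f := deriv v)
    (f' := deriv (deriv v)) (s := Ico a T) (fun t ht => ?_) (fun t ht => ?_) (convex_Ico a T) hx hy
  · exact (h.diff_deriv t ⟨ha.trans_le ht.1, ht.2⟩).hasDerivWithinAt
  · refine (h.bound_deriv₂ t ⟨ha.trans_le ht.1, ht.2⟩).trans ?_
    have := Real.rpow_le_rpow_of_nonpos ha ht.1 (by linarith : α - 2 ≤ 0)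
    gcongr

lemma abs_deriv_sub_slope_le (hα1 : α < 1) (hA : 0 ≤ A) (h : WeaklySingular α T A v) {a b s : ℝ}
    (ha : 0 < a) (hab : a < b) (hb : b ≤ T) (hs : s ∈ Ioo a b) :
    |deriv v s - (v b - v a) / (b - a)| ≤ A * a ^ (α - 2) * (b - a) := by
  obtain ⟨c, hc, hc'⟩ := exists_hasDerivAt_eq_slope v (deriv v) hab
    (h.cont.mono (Icc_subset_Icc ha.le hb))
    (fun x hx => h.diff x ⟨ha.trans hx.1, hx.2.trans_le hb⟩)
  rw [← hc']
  refine (h.abs_deriv_sub_le hα1 hA ha ⟨hc.1.le, hc.2.trans_le hb⟩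
    ⟨hs.1.le, hs.2.trans_le hb⟩).trans ?_
  have : |s - c| ≤ b - a := by
    rw [abs_le]
    constructor <;> linarith [hs.1, hs.2, hc.1, hc.2]
  have := Real.rpow_nonneg ha.le (α - 2)
  gcongr

/-- By the mean value theorem on [a, s], the interpolation error is (v'(c) - slope)(s - a); the
slope is itself a value of v', so one bound on v'' suffices. -/
lemma abs_sub_chord_le (hα1 : α < 1) (hA : 0 ≤ A) (h : WeaklySingular α T A v) {a b s : ℝ}
    (ha : 0 < a) (hab : a < b) (hb : b ≤ T) (hs : s ∈ Icc a b) :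
    |v s - (v a * (b - s) + v b * (s - a)) / (b - a)| ≤ A * a ^ (α - 2) * (b - a) ^ 2 := by
  have hd : b - a ≠ 0 := (sub_pos.2 hab).ne'
  have hp := Real.rpow_nonneg ha.le (α - 2)
  rcases hs.1.eq_or_lt with rfl | hs1
  · rw [show v a - (v a * (b - a) + v b * (a - a)) / (b - a) = 0 by field_simp; ring, abs_zero]
    positivity
  · obtain ⟨c, hc, hc'⟩ := exists_hasDerivAt_eq_slope v (deriv v) hs1
      (h.cont.mono (Icc_subset_Icc ha.le (hs.2.trans hb)))
      (fun x hx => h.diff x ⟨ha.trans hx.1, hx.2.trans_le (hs.2.trans hb)⟩)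
    have hsa : s - a ≠ 0 := (sub_pos.2 hs1).ne'
    have e : v s - (v a * (b - s) + v b * (s - a)) / (b - a) =
        (deriv v c - (v b - v a) / (b - a)) * (s - a) := by
      rw [hc']
      field_simp
      ring
    rw [e, abs_mul, abs_of_pos (sub_pos.2 hs1), sq, ← mul_assoc]
    refine mul_le_mul (h.abs_deriv_sub_slope_le hα1 hA ha hab hb ⟨hc.1, hc.2.trans_le hs.2⟩)
      (by linarith [hs.2]) (sub_pos.2 hs1).le ?_
    have := sub_pos.2 hab
    positivity

/-- An integrable majorant of `s ^ (α - 1) * (t - s) ^ (-α)`. -/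
lemma singular_mul_le (hα0 : 0 < α) (hα1 : α < 1) {t s : ℝ} (hs : s ∈ Ioo 0 t) :
    s ^ (α - 1) * (t - s) ^ (-α) ≤
      s ^ (α - 1) * (t / 2) ^ (-α) + (t / 2) ^ (α - 1) * (t - s) ^ (-α) := by
  have ht : 0 < t / 2 := by linarith [hs.1, hs.2]
  have h1 : 0 ≤ s ^ (α - 1) := Real.rpow_nonneg hs.1.le _
  have h2 : 0 ≤ (t - s) ^ (-α) := Real.rpow_nonneg (by linarith [hs.2]) _
  have h3 : 0 ≤ (t / 2) ^ (-α) := Real.rpow_nonneg ht.le _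
  have h4 : 0 ≤ (t / 2) ^ (α - 1) := Real.rpow_nonneg ht.le _
  -- On each half of (0, t) only one of the two factors is singular.
  rcases le_total s (t / 2) with h | h
  · have := Real.rpow_le_rpow_of_nonpos ht (by linarith : t / 2 ≤ t - s) (by linarith : -α ≤ 0)
    nlinarith [mul_nonneg h4 h2]
  · have := Real.rpow_le_rpow_of_nonpos ht h (by linarith : α - 1 ≤ 0)
    nlinarith [mul_nonneg h1 h3]

lemma intervalIntegrable_sub_rpow (hα1 : α < 1) (a b c : ℝ) :
    IntervalIntegrable (fun s => (c - s) ^ (-α)) MeasureTheory.volume a b := by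
  have := (intervalIntegral.intervalIntegrable_rpow' (a := c - a) (b := c - b)
    (by linarith : -1 < -α)).comp_sub_left c
  simpa using this

lemma integral_sub_rpow (hα1 : α < 1) {a b : ℝ} :
    ∫ s in a..b, (b - s) ^ (-α) = (b - a) ^ (1 - α) / (1 - α) := by
  rw [intervalIntegral.integral_comp_sub_left (fun w => w ^ (-α)),
    integral_rpow (Or.inl (by linarith)), sub_self, Real.zero_rpow (by linarith), sub_zero,
    show -α + 1 = 1 - α by ring]

lemma intervalIntegrable_majorant (hα0 : 0 < α) (hα1 : α < 1) (t : ℝ) :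
    IntervalIntegrable (fun s => s ^ (α - 1) * (t / 2) ^ (-α) + (t / 2) ^ (α - 1) * (t - s) ^ (-α))
      MeasureTheory.volume 0 t :=
  ((intervalIntegral.intervalIntegrable_rpow' (by linarith)).mul_const _).add
    ((intervalIntegrable_sub_rpow hα1 0 t t).const_mul _)

/-- Scale invariance: the exponents α - 1 and -α add up to -1, so the value is independent of t. On
the first mesh interval the truncation error is therefore bounded, and no better. -/
lemma integral_majorant (hα0 : 0 < α) (hα1 : α < 1) {t : ℝ} (ht : 0 < t) :
    ∫ s in (0 : ℝ)..t, (s ^ (α - 1) * (t / 2) ^ (-α) + (t / 2) ^ (α - 1) * (t - s) ^ (-α)) =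
      2 ^ α / α + 2 ^ (1 - α) / (1 - α) := by
  rw [intervalIntegral.integral_add
    ((intervalIntegral.intervalIntegrable_rpow' (by linarith)).mul_const _)
    ((intervalIntegrable_sub_rpow hα1 0 t t).const_mul _),
    intervalIntegral.integral_mul_const, intervalIntegral.integral_const_mul,
    integral_sub_rpow hα1, integral_rpow (Or.inl (by linarith)), sub_add_cancel,
    Real.zero_rpow hα0.ne', sub_zero, sub_zero, Real.div_rpow ht.le (by norm_num),
    Real.div_rpow ht.le (by norm_num), Real.rpow_neg ht.le, Real.rpow_neg (by norm_num : (0:ℝ) ≤ 2),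
    show α - 1 = -(1 - α) by ring, Real.rpow_neg ht.le, Real.rpow_neg (by norm_num : (0:ℝ) ≤ 2)]
  have h1 : t ^ α ≠ 0 := (Real.rpow_pos_of_pos ht _).ne'
  have h2 : t ^ (1 - α) ≠ 0 := (Real.rpow_pos_of_pos ht _).ne'
  have h3 : 1 - α ≠ 0 := by linarith
  field_simp

lemma continuousOn_deriv (h : WeaklySingular α T A v) : ContinuousOn (deriv v) (Ioo 0 T) :=
  fun t ht => (h.diff_deriv t ht).continuousAt.continuousWithinAt

lemma intervalIntegrable_of_abs_le {F : ℝ → ℝ} {G : ℝ → ℝ} {a b : ℝ} (hab : a ≤ b)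
    (hF : ContinuousOn F (Ioo a b)) (hG : IntervalIntegrable G MeasureTheory.volume a b)
    (hle : ∀ s ∈ Ioo a b, |F s| ≤ G s) : IntervalIntegrable F MeasureTheory.volume a b := by
  rw [intervalIntegrable_iff_integrableOn_Ioo_of_le hab] at hG ⊢
  refine MeasureTheory.Integrable.mono' hG (hF.aestronglyMeasurable measurableSet_Ioo) ?_
  exact (MeasureTheory.ae_restrict_iff' measurableSet_Ioo).2 (Filter.Eventually.of_forall hle)

lemma intervalIntegrable_deriv (hα0 : 0 < α) (h : WeaklySingular α T A v)
    {t : ℝ} (ht0 : 0 ≤ t) (htT : t ≤ T) : IntervalIntegrable (deriv v) MeasureTheory.volume 0 t :=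
  intervalIntegrable_of_abs_le ht0 (h.continuousOn_deriv.mono (Ioo_subset_Ioo_right htT))
    ((intervalIntegral.intervalIntegrable_rpow' (by linarith)).const_mul A)
    fun s hs => h.bound_deriv s ⟨hs.1, hs.2.trans_le htT⟩

lemma abs_deriv_mul_le (hα0 : 0 < α) (hα1 : α < 1) (hA : 0 ≤ A) (h : WeaklySingular α T A v)
    {t s : ℝ} (htT : t ≤ T) (hs : s ∈ Ioo 0 t) :
    |deriv v s * (t - s) ^ (-α)| ≤
      A * (s ^ (α - 1) * (t / 2) ^ (-α) + (t / 2) ^ (α - 1) * (t - s) ^ (-α)) := by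
  have h2 : 0 ≤ (t - s) ^ (-α) := Real.rpow_nonneg (by linarith [hs.2]) _
  rw [abs_mul, abs_of_nonneg h2]
  calc _ ≤ A * s ^ (α - 1) * (t - s) ^ (-α) :=
        mul_le_mul_of_nonneg_right (h.bound_deriv s ⟨hs.1, hs.2.trans_le htT⟩) h2
    _ = A * (s ^ (α - 1) * (t - s) ^ (-α)) := by ring
    _ ≤ _ := mul_le_mul_of_nonneg_left (singular_mul_le hα0 hα1 hs) hA

lemma intervalIntegrable_deriv_mul (hα0 : 0 < α) (hα1 : α < 1) (hA : 0 ≤ A)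
    (h : WeaklySingular α T A v) {t : ℝ} (ht0 : 0 < t) (htT : t ≤ T) :
    IntervalIntegrable (fun s => deriv v s * (t - s) ^ (-α)) MeasureTheory.volume 0 t := by
  refine intervalIntegrable_of_abs_le ht0.le
    ((h.continuousOn_deriv.mono (Ioo_subset_Ioo_right htT)).mul ?_)
    ((intervalIntegrable_majorant hα0 hα1 t).const_mul A)
    fun s hs => h.abs_deriv_mul_le hα0 hα1 hA htT hs
  refine ContinuousOn.rpow_const (by fun_prop) fun y hy => Or.inl ?_
  have := hy.2
  linarith

/-- Integration by parts away from the singularity of the kernel, since a < t. At 0 the derivative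
v' is unbounded but integrable, and v is continuous up to the endpoint. -/
lemma integral_deriv_mul (hα0 : 0 < α) (h : WeaklySingular α T A v)
    {a t : ℝ} (ha : 0 ≤ a) (hat : a < t) (htT : t ≤ T) :
    ∫ s in (0 : ℝ)..a, deriv v s * (t - s) ^ (-α) =
      v a * (t - a) ^ (-α) - v 0 * t ^ (-α) -
        α * ∫ s in (0 : ℝ)..a, v s * (t - s) ^ (-(1 + α)) := by
  have hne : ∀ s ∈ Icc 0 a, t - s ≠ 0 := fun s hs => by linarith [hs.2]
  have hcont : ContinuousOn (fun s => (t - s) ^ (-(1 + α))) (uIcc 0 a) := by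
    rw [uIcc_of_le ha]
    exact ContinuousOn.rpow_const (by fun_prop) fun y hy => Or.inl (hne y hy)
  have key := intervalIntegral.integral_mul_deriv_eq_deriv_mul_of_hasDerivAt (a := 0) (b := a)
    (u := fun s => (t - s) ^ (-α)) (v := v) (u' := fun s => α * (t - s) ^ (-(1 + α)))
    (v' := deriv v) ?_ ?_ ?_ ?_ ?_ ?_
  · simp only [sub_zero] at key
    rw [← intervalIntegral.integral_const_mul]
    simp only [mul_comm (deriv v _)]
    rw [key]
    congr 1
    · ring
    · refine intervalIntegral.integral_congr fun s _ => ?_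
      ring
  · rw [uIcc_of_le ha]
    exact ContinuousOn.rpow_const (by fun_prop) fun y hy => Or.inl (hne y hy)
  · rw [uIcc_of_le ha]
    exact h.cont.mono (Icc_subset_Icc_right (hat.le.trans htT))
  · rw [min_eq_left ha, max_eq_right ha]
    intro s hs
    refine (((hasDerivAt_id s).const_sub t).rpow_const (p := -α)
      (Or.inl (hne s ⟨hs.1.le, hs.2.le⟩))).congr_deriv ?_
    simp only [id]
    rw [show -α - 1 = -(1 + α) by ring]
    ring
  · rw [min_eq_left ha, max_eq_right ha]
    exact fun s hs => h.diff s ⟨hs.1, hs.2.trans (hat.trans_le htT)⟩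
  · exact (hcont.intervalIntegrable).const_mul α
  · exact h.intervalIntegrable_deriv hα0 ha (hat.le.trans htT)

end WeaklySingular

/-! ### Temporal truncation error -/

lemma meshTime_rpow_le {α T r : ℝ} {N : ℕ} (hα1 : α < 1) (hT : 0 < T) (hr : 1 ≤ r) (hN : 1 ≤ N)
    (n : ℕ) : meshTime T r N (n + 1) ^ (α - 2) ≤
      2 ^ (r * (2 - α)) * meshTime T r N (n + 2) ^ (α - 2) := by
  have h1 := meshTime_pos (r := r) hT hN n
  have h2 := meshTime_pos (r := r) hT hN (n + 1)
  have h := Real.rpow_le_rpow_of_nonpos h2 (meshTime_succ_le (N := N) hT hr n)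
    (by linarith : α - 2 ≤ 0)
  rw [Real.mul_rpow (by positivity) h1.le, ← Real.rpow_mul (by norm_num)] at h
  have e : (2 : ℝ) ^ (r * (2 - α)) * 2 ^ (r * (α - 2)) = 1 := by
    rw [← Real.rpow_add (by norm_num)]; ring_nf; simp
  have h3 := mul_le_mul_of_nonneg_left h
    (Real.rpow_nonneg (by norm_num : (0 : ℝ) ≤ 2) (r * (2 - α)))
  rw [← mul_assoc, e, one_mul] at h3
  exact h3

/-- For k ≥ 1 this is τ² times the bound t_k^{α-2} on v'', where τ ≤ r t_{k+1}/(k+1) and t_k is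
comparable to t_{k+1}. On the first interval v'' is useless and the variation of v, at most (A/α)
t_1^α, has the same form. -/
lemma abs_sub_interp_le {α T A r : ℝ} {N : ℕ} {v : ℝ → ℝ} (hα0 : 0 < α) (hα1 : α < 1)
    (hT : 0 < T) (hr : 1 ≤ r) (hN : 1 ≤ N) (h : WeaklySingular α T A v) {k : ℕ} (hk : k + 1 ≤ N)
    {y : ℝ} (hy : y ∈ Icc (meshTime T r N k) (meshTime T r N (k + 1))) :
    |v y - interp T r N (fun j => v (meshTime T r N j)) k y| ≤
      (1 / α + 2 ^ (r * (2 - α)) * r ^ 2) * A *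
        (meshTime T r N (k + 1) ^ α / ((k : ℝ) + 1) ^ 2) := by
  have hA := h.nonneg hT
  have hkT := meshTime_le hT hr hk
  have hτ := meshStep_pos hT hr hN k
  rcases k with _ | k
  · have ht := meshTime_pos (r := r) hT hN 0
    simp only [zero_add, meshTime_zero hr] at *
    set b := meshTime T r N 1 with hb
    have hstep : meshStep T r N 1 = b := by simp [meshStep, meshTime_zero hr, hb]
    have h1 := h.abs_sub_le hα0 le_rfl hy.1 (hy.2.trans hkT)
    have h2 := h.abs_sub_le hα0 hy.1 hy.2 hkT
    rw [Real.zero_rpow hα0.ne', sub_zero] at h1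
    have hyb : y ^ α ≤ b ^ α := Real.rpow_le_rpow hy.1 hy.2 hα0.le
    have hy0 : 0 ≤ y ^ α := Real.rpow_nonneg hy.1 _
    have hAα : 0 ≤ A / α := by positivity
    have h3 : |v y - v 0| ≤ A / α * b ^ α := h1.trans (mul_le_mul_of_nonneg_left hyb hAα)
    have h4 : |v y - v b| ≤ A / α * b ^ α := by
      rw [abs_sub_comm]
      exact h2.trans (mul_le_mul_of_nonneg_left (by linarith) hAα)
    have e : v y - interp T r N (fun j => v (meshTime T r N j)) 0 y =
        ((v y - v 0) * (b - y) + (v y - v b) * y) / b := by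
      simp only [interp, meshTime_zero hr, zero_add, hstep, ← hb]
      field_simp
      ring
    rw [e, abs_div, abs_of_pos ht, div_le_iff₀ ht]
    have h5 : |(v y - v 0) * (b - y) + (v y - v b) * y| ≤
        A / α * b ^ α * (b - y) + A / α * b ^ α * y := by
      refine (abs_add_le _ _).trans (add_le_add ?_ ?_)
      · rw [abs_mul, abs_of_nonneg (sub_nonneg.2 hy.2)]
        exact mul_le_mul_of_nonneg_right h3 (sub_nonneg.2 hy.2)
      · rw [abs_mul, abs_of_nonneg hy.1]
        exact mul_le_mul_of_nonneg_right h4 hy.1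
    refine h5.trans ?_
    have h6 : 0 ≤ 2 ^ (r * (2 - α)) * r ^ 2 * A * b ^ α * b := by positivity
    simp only [Nat.cast_zero, zero_add, one_pow, div_one]
    have e7 : (1 / α + 2 ^ (r * (2 - α)) * r ^ 2) * A * b ^ α * b =
      A / α * b ^ α * (b - y) + A / α * b ^ α * y + 2 ^ (r * (2 - α)) * r ^ 2 * A * b ^ α * b := by
      ring
    linarith
  · have ht := meshTime_pos (r := r) hT hN k
    have ht2 := meshTime_pos (r := r) hT hN (k + 1)
    have h1 := h.abs_sub_chord_le hα1 hA ht (meshTime_strictMono hT hr hN (k + 1).lt_succ_self)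
      hkT hy
    rw [← meshStep_succ] at h1
    refine h1.trans ?_
    have h2 := meshTime_rpow_le hα1 hT hr hN k
    have h3 := meshStep_le (N := N) hT hr (k + 1)
    have h4 : 0 ≤ meshTime T r N (k + 1) ^ (α - 2) := by positivity
    calc A * meshTime T r N (k + 1) ^ (α - 2) * meshStep T r N (k + 2) ^ 2
        ≤ A * (2 ^ (r * (2 - α)) * meshTime T r N (k + 2) ^ (α - 2)) *
          (r * meshTime T r N (k + 2) / (((k + 1 : ℕ) : ℝ) + 1)) ^ 2 := by gcongr
      _ = 2 ^ (r * (2 - α)) * r ^ 2 * A *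
          (meshTime T r N (k + 2) ^ α / (((k + 1 : ℕ) : ℝ) + 1) ^ 2) := by
        rw [show α - 2 = α - (2 : ℕ) by norm_num, Real.rpow_sub_natCast ht2.ne']
        field_simp
      _ ≤ _ := by
        have : 0 ≤ 1 / α := by positivity
        gcongr
        linarith

/-- Let x = t_{k+1} and y = t_{n+1}, and split at 2(k+1) = n+1. For early intervals x ≤ y/2, so the
kernel is at most (y/2)^{-1-α} and the term is at most a constant times (x/y)^{1+α} (k+1)^{-3};
spending the power β of (k+1)/(n+1) leaves the summable (k+1)^{-1-α}. For late intervals the weight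
is at most 4 y^α/(n+1)², and the kernel integrals add up to at most τ^{-α}/α ≤ y^{-α}(n+1)^α/α. -/
lemma exists_sum_kernel_bound {α r : ℝ} (hα0 : 0 < α) (hα1 : α < 1) (hr : 1 ≤ r) :
    ∃ C : ℝ, 0 ≤ C ∧ ∀ (T : ℝ) (N n : ℕ), 0 < T → 1 ≤ N →
      ∑ k ∈ Finset.range n, meshTime T r N (k + 1) ^ α / ((k : ℝ) + 1) ^ 2 *
        (∫ y in meshTime T r N k..meshTime T r N (k + 1),
          (meshTime T r N (n + 1) - y) ^ (-(1 + α))) ≤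
      C * ((n : ℝ) + 1) ^ (-(min (2 - α) (r * α))) := by
  set β := min (2 - α) (r * α) with hβ
  have hβ1 : β ≤ 2 - α := min_le_left _ _
  have hβ2 : β ≤ r * α := min_le_right _ _
  have hsum : Summable fun k : ℕ => ((k : ℝ) + 1) ^ (-(1 + α)) := by
    have := (summable_nat_add_iff (f := fun k : ℕ => (k : ℝ) ^ (-(1 + α))) 1).2
      (Real.summable_nat_rpow.2 (by linarith))
    simpa using this
  set S := ∑' k : ℕ, ((k : ℝ) + 1) ^ (-(1 + α)) with hS
  have hS0 : 0 ≤ S := tsum_nonneg fun k => by positivity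
  refine ⟨r * 2 ^ (1 + α) * S + 4 / α, by positivity, fun T N n hT hN => ?_⟩
  have hy := meshTime_pos (r := r) hT hN n
  set y := meshTime T r N (n + 1) with hydef
  have hm : (0 : ℝ) < (n : ℝ) + 1 := by positivity
  have hterm : ∀ k ∈ Finset.range n, meshTime T r N (k + 1) ^ α / ((k : ℝ) + 1) ^ 2 *
        (∫ s in meshTime T r N k..meshTime T r N (k + 1), (y - s) ^ (-(1 + α))) ≤
      r * 2 ^ (1 + α) * ((n : ℝ) + 1) ^ (-β) * ((k : ℝ) + 1) ^ (-(1 + α)) +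
        4 / ((n : ℝ) + 1) ^ 2 * y ^ α *
          (∫ s in meshTime T r N k..meshTime T r N (k + 1), (y - s) ^ (-(1 + α))) := by
    intro k hk
    rw [Finset.mem_range] at hk
    have hx := meshTime_pos (r := r) hT hN k
    set x := meshTime T r N (k + 1) with hxdef
    have hj : (0 : ℝ) < (k : ℝ) + 1 := by positivity
    have hkn : (k : ℝ) + 1 ≤ n := by exact_mod_cast hk
    have hxy : x < y := meshTime_strictMono hT hr hN (by omega)
    have hx' : meshTime T r N k ≤ x := meshTime_mono hT hr k.le_succ
    have hx0 := meshTime_nonneg (r := r) (N := N) hT k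
    have hq : 0 ≤ ∫ s in meshTime T r N k..x, (y - s) ^ (-(1 + α)) :=
      intervalIntegral.integral_nonneg hx' fun s hs => Real.rpow_nonneg (by linarith [hs.2]) _
    rcases le_total (2 * ((k : ℝ) + 1)) ((n : ℝ) + 1) with h | h
    · have hxe : x = y * (((k : ℝ) + 1) / ((n : ℝ) + 1)) ^ r := by
        have := meshTime_eq_mul (T := T) (r := r) (N := N) (k + 1) (n := n + 1) (by omega)
        push_cast at this
        exact this
      have hratio : ((k : ℝ) + 1) / ((n : ℝ) + 1) ≤ 1 / 2 := by
        rw [div_le_iff₀ hm]; linarith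
      have hxh : x ≤ y / 2 := by
        have h1 := Real.rpow_le_self_of_le_one
          (by positivity : 0 ≤ ((k : ℝ) + 1) / ((n : ℝ) + 1)) (by linarith) hr
        rw [hxe]
        nlinarith
      have hq2 : (∫ s in meshTime T r N k..x, (y - s) ^ (-(1 + α))) ≤
          (y / 2) ^ (-(1 + α)) * (r * x / ((k : ℝ) + 1)) := by
        have h1 := intervalIntegral.norm_integral_le_of_norm_le_const (a := meshTime T r N k)
          (b := x) (f := fun s => (y - s) ^ (-(1 + α))) (C := (y / 2) ^ (-(1 + α))) (by
            intro s hs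
            rw [uIoc_of_le hx'] at hs
            rw [Real.norm_of_nonneg (Real.rpow_nonneg (by linarith [hs.2]) _)]
            exact Real.rpow_le_rpow_of_nonpos (by positivity) (by linarith [hs.2])
              (by linarith))
        rw [abs_of_nonneg (sub_nonneg.2 hx')] at h1
        refine (Real.le_norm_self _).trans (h1.trans ?_)
        exact mul_le_mul_of_nonneg_left (meshStep_le hT hr k) (by positivity)
      have hpow : (x / y) ^ (1 + α) ≤ ((k : ℝ) + 1) ^ β * ((n : ℝ) + 1) ^ (-β) := by
        have e : x / y = (((k : ℝ) + 1) / ((n : ℝ) + 1)) ^ r := by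
          rw [hxe]; field_simp
        rw [e, ← Real.rpow_mul (by positivity), Real.rpow_neg hm.le, ← div_eq_mul_inv,
          ← Real.div_rpow hj.le hm.le]
        -- The ratio is at most 1 and β ≤ rα ≤ r(1+α).
        exact Real.rpow_le_rpow_of_exponent_ge (by positivity) (by linarith) (by nlinarith)
      have hpow2 : ((k : ℝ) + 1) ^ β / ((k : ℝ) + 1) ^ 3 ≤ ((k : ℝ) + 1) ^ (-(1 + α)) := by
        rw [← Real.rpow_sub_natCast hj.ne']
        exact Real.rpow_le_rpow_of_exponent_le (by linarith) (by push_cast; linarith)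
      have hrest : 0 ≤ 4 / ((n : ℝ) + 1) ^ 2 * y ^ α *
          (∫ s in meshTime T r N k..x, (y - s) ^ (-(1 + α))) := mul_nonneg (by positivity) hq
      calc x ^ α / ((k : ℝ) + 1) ^ 2 * (∫ s in meshTime T r N k..x, (y - s) ^ (-(1 + α)))
          ≤ x ^ α / ((k : ℝ) + 1) ^ 2 * ((y / 2) ^ (-(1 + α)) * (r * x / ((k : ℝ) + 1))) :=
            mul_le_mul_of_nonneg_left hq2 (by positivity)
        _ = r * 2 ^ (1 + α) * ((x / y) ^ (1 + α) / ((k : ℝ) + 1) ^ 3) := by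
            rw [Real.div_rpow hx.le hy.le, Real.div_rpow hy.le (by norm_num),
              Real.rpow_neg hy.le, Real.rpow_neg (by norm_num : (0 : ℝ) ≤ 2),
              Real.rpow_add hx, Real.rpow_one]
            have : y ^ (1 + α) ≠ 0 := (Real.rpow_pos_of_pos hy _).ne'
            have : (2 : ℝ) ^ (1 + α) ≠ 0 := (Real.rpow_pos_of_pos (by norm_num) _).ne'
            field_simp
        _ ≤ r * 2 ^ (1 + α) * (((k : ℝ) + 1) ^ β * ((n : ℝ) + 1) ^ (-β) / ((k : ℝ) + 1) ^ 3) := by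
            gcongr
        _ = r * 2 ^ (1 + α) * ((n : ℝ) + 1) ^ (-β) * (((k : ℝ) + 1) ^ β / ((k : ℝ) + 1) ^ 3) := by
            ring
        _ ≤ r * 2 ^ (1 + α) * ((n : ℝ) + 1) ^ (-β) * ((k : ℝ) + 1) ^ (-(1 + α)) := by
            gcongr
        _ ≤ _ := by linarith
    · have h1 : x ^ α / ((k : ℝ) + 1) ^ 2 ≤ 4 / ((n : ℝ) + 1) ^ 2 * y ^ α := by
        have h2 : x ^ α ≤ y ^ α := Real.rpow_le_rpow hx.le hxy.le hα0.le
        rw [div_mul_eq_mul_div, div_le_div_iff₀ (by positivity) (by positivity)]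
        have h3 : ((n : ℝ) + 1) ^ 2 ≤ 4 * ((k : ℝ) + 1) ^ 2 := by nlinarith
        calc _ ≤ y ^ α * (4 * ((k : ℝ) + 1) ^ 2) := by gcongr
          _ = _ := by ring
      have h2 := mul_le_mul_of_nonneg_right h1 hq
      have h3 : 0 ≤ r * 2 ^ (1 + α) * ((n : ℝ) + 1) ^ (-β) * ((k : ℝ) + 1) ^ (-(1 + α)) := by
        positivity
      linarith
  refine (Finset.sum_le_sum hterm).trans ?_
  rw [Finset.sum_add_distrib, ← Finset.mul_sum, ← Finset.mul_sum,
    sum_integral_kernel hα0 hT hr hN]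
  have h1 : ∑ k ∈ Finset.range n, ((k : ℝ) + 1) ^ (-(1 + α)) ≤ S :=
    hsum.sum_le_tsum _ fun k _ => by positivity
  have hτ := meshStep_pos hT hr hN n
  have h2 : y ^ α * (meshStep T r N (n + 1) ^ (-α) - y ^ (-α)) ≤ ((n : ℝ) + 1) ^ α := by
    have h3 := Real.rpow_le_rpow (by positivity) (le_meshStep (N := N) hT hr n) hα0.le
    rw [Real.div_rpow hy.le hm.le, div_le_iff₀ (by positivity)] at h3
    have h4 : y ^ α * meshStep T r N (n + 1) ^ (-α) ≤ ((n : ℝ) + 1) ^ α := by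
      rw [Real.rpow_neg hτ.le, ← div_eq_mul_inv, div_le_iff₀ (by positivity)]
      linarith
    have h5 : 0 ≤ y ^ α * y ^ (-α) := by positivity
    linarith
  have h6 : ((n : ℝ) + 1) ^ α / ((n : ℝ) + 1) ^ 2 ≤ ((n : ℝ) + 1) ^ (-β) := by
    rw [← Real.rpow_sub_natCast hm.ne']
    exact Real.rpow_le_rpow_of_exponent_le (by have : (0 : ℝ) ≤ n := by positivity
                                               linarith) (by push_cast; linarith)
  calc _ ≤ r * 2 ^ (1 + α) * ((n : ℝ) + 1) ^ (-β) * S +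
        4 / α * (((n : ℝ) + 1) ^ α / ((n : ℝ) + 1) ^ 2) := by
        refine add_le_add (mul_le_mul_of_nonneg_left h1 (by positivity)) ?_
        calc _ = 4 / α * (y ^ α * (meshStep T r N (n + 1) ^ (-α) - y ^ (-α)) /
              ((n : ℝ) + 1) ^ 2) := by ring
          _ ≤ _ := by gcongr
    _ ≤ r * 2 ^ (1 + α) * ((n : ℝ) + 1) ^ (-β) * S + 4 / α * ((n : ℝ) + 1) ^ (-β) := by
        gcongr
    _ = _ := by ring

/-- For n ≥ 1 the slope error A t_n^{α-2} τ times the kernel mass τ^{1-α}/(1-α) gives (τ/t)^{2-α},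
hence order (n+1)^{-(2-α)}. For n = 0 slope and derivative are bounded separately, and the powers of
t_1 cancel. -/
lemma integral_slope_sub_deriv_bound {α r T A : ℝ} {N n : ℕ} {v : ℝ → ℝ} (hα0 : 0 < α)
    (hα1 : α < 1) (hr : 1 ≤ r) (hT : 0 < T) (hN : 1 ≤ N) (h : WeaklySingular α T A v)
    (hn : n + 1 ≤ N) :
    |∫ s in meshTime T r N n..meshTime T r N (n + 1),
      ((v (meshTime T r N (n + 1)) - v (meshTime T r N n)) / meshStep T r N (n + 1) - deriv v s) *
        (meshTime T r N (n + 1) - s) ^ (-α)| ≤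
      (2 ^ (r * (2 - α)) * r ^ (2 - α) / (1 - α) + 1 / α / (1 - α) +
        (2 ^ α / α + 2 ^ (1 - α) / (1 - α))) * A *
        ((n : ℝ) + 1) ^ (-(min (2 - α) (r * α))) := by
  have hA := h.nonneg hT
  have h1α : 0 < 1 - α := by linarith
  have hnT := meshTime_le hT hr hn
  have hτ := meshStep_pos hT hr hN n
  have hle : meshTime T r N n ≤ meshTime T r N (n + 1) := meshTime_mono hT hr n.le_succ
  have hlt : meshTime T r N n < meshTime T r N (n + 1) := meshTime_strictMono hT hr hN n.lt_succ_self
  rw [← Real.norm_eq_abs]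
  rcases n with _ | n
  · have ht := meshTime_pos (r := r) hT hN 0
    simp only [zero_add, meshTime_zero hr] at *
    set b := meshTime T r N 1 with hb
    have hstep : meshStep T r N 1 = b := by simp [meshStep, meshTime_zero hr, hb]
    rw [hstep]
    have h1 := h.abs_sub_le hα0 le_rfl hle hnT
    rw [Real.zero_rpow hα0.ne', sub_zero] at h1
    have hint := ((WeaklySingular.intervalIntegrable_sub_rpow hα1 0 b b).const_mul
      (A / α * b ^ α / b)).add
      ((WeaklySingular.intervalIntegrable_majorant hα0 hα1 b).const_mul A)
    refine (intervalIntegral.norm_integral_le_of_norm_le hle ?_ hint).trans ?_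
    · refine Filter.Eventually.of_forall fun s hs => ?_
      -- At the right endpoint the kernel is `0 ^ (-α)`, which is 0 by convention, so the integrand
      -- vanishes there.
      rcases hs.2.eq_or_lt with rfl | hsb
      · have := Real.rpow_nonneg hs.1.le (α - 1)
        simp only [sub_self, Real.zero_rpow (neg_ne_zero.2 hα0.ne'), mul_zero, norm_zero]
        positivity
      · have hp : 0 ≤ (b - s) ^ (-α) := Real.rpow_nonneg (by linarith) _
        rw [sub_mul]
        refine (norm_sub_le _ _).trans (add_le_add ?_
          (h.abs_deriv_mul_le hα0 hα1 hA hnT ⟨hs.1, hsb⟩))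
        rw [Real.norm_eq_abs, abs_mul, abs_of_nonneg hp, abs_div, abs_of_pos ht]
        gcongr
    · rw [intervalIntegral.integral_add
        ((WeaklySingular.intervalIntegrable_sub_rpow hα1 0 b b).const_mul _)
        ((WeaklySingular.intervalIntegrable_majorant hα0 hα1 b).const_mul A),
        intervalIntegral.integral_const_mul, intervalIntegral.integral_const_mul,
        WeaklySingular.integral_majorant hα0 hα1 ht, WeaklySingular.integral_sub_rpow hα1]
      have e : A / α * b ^ α / b * ((b - 0) ^ (1 - α) / (1 - α)) = 1 / α / (1 - α) * A := by
        rw [sub_zero, Real.rpow_sub ht, Real.rpow_one]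
        have : b ^ α ≠ 0 := (Real.rpow_pos_of_pos ht _).ne'
        field_simp
      rw [e]
      simp only [Nat.cast_zero, zero_add, Real.one_rpow, mul_one]
      have : 0 ≤ 2 ^ (r * (2 - α)) * r ^ (2 - α) / (1 - α) * A := by positivity
      linarith
  · have ht := meshTime_pos (r := r) hT hN n
    have ht2 := meshTime_pos (r := r) hT hN (n + 1)
    set a := meshTime T r N (n + 1) with ha
    set b := meshTime T r N (n + 1 + 1) with hb
    have hstep : meshStep T r N (n + 1 + 1) = b - a := rfl
    have hint := (WeaklySingular.intervalIntegrable_sub_rpow hα1 a b b).const_mul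
      (A * a ^ (α - 2) * (b - a))
    refine (intervalIntegral.norm_integral_le_of_norm_le hle ?_ hint).trans ?_
    · refine Filter.Eventually.of_forall fun s hs => ?_
      rcases hs.2.eq_or_lt with rfl | hsb
      · simp [Real.zero_rpow (neg_ne_zero.2 hα0.ne')]
      · have hp : 0 ≤ (b - s) ^ (-α) := Real.rpow_nonneg (by linarith) _
        rw [Real.norm_eq_abs, abs_mul, abs_of_nonneg hp, abs_sub_comm, hstep]
        exact mul_le_mul_of_nonneg_right
          (h.abs_deriv_sub_slope_le hα1 hA ht hlt hnT ⟨hs.1, hsb⟩) hp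
    · rw [intervalIntegral.integral_const_mul, WeaklySingular.integral_sub_rpow hα1, ← hstep]
      have h2 := meshTime_rpow_le hα1 hT hr hN n
      have h3 := Real.rpow_le_rpow hτ.le (meshStep_le (N := N) hT hr (n + 1))
        (by linarith : 0 ≤ 2 - α)
      have hm : (0 : ℝ) < ((n + 1 : ℕ) : ℝ) + 1 := by positivity
      have h4 : (((n + 1 : ℕ) : ℝ) + 1) ^ (-(2 - α)) ≤
          (((n + 1 : ℕ) : ℝ) + 1) ^ (-(min (2 - α) (r * α))) :=
        Real.rpow_le_rpow_of_exponent_le (by linarith [(n + 1).cast_nonneg (α := ℝ)])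
          (neg_le_neg (min_le_left _ _))
      calc A * a ^ (α - 2) * meshStep T r N (n + 1 + 1) *
            (meshStep T r N (n + 1 + 1) ^ (1 - α) / (1 - α))
          = A * a ^ (α - 2) * meshStep T r N (n + 1 + 1) ^ (2 - α) / (1 - α) := by
            rw [show 2 - α = 1 + (1 - α) by ring, Real.rpow_add hτ, Real.rpow_one]
            ring
        _ ≤ A * (2 ^ (r * (2 - α)) * b ^ (α - 2)) *
            (r * b / (((n + 1 : ℕ) : ℝ) + 1)) ^ (2 - α) / (1 - α) := by
            gcongr
        _ = 2 ^ (r * (2 - α)) * r ^ (2 - α) / (1 - α) * A *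
            (((n + 1 : ℕ) : ℝ) + 1) ^ (-(2 - α)) := by
            rw [Real.div_rpow (by positivity) hm.le, Real.mul_rpow (by positivity) ht2.le,
              Real.rpow_neg hm.le, show α - 2 = -(2 - α) by ring, Real.rpow_neg ht2.le]
            have : b ^ (2 - α) ≠ 0 := (Real.rpow_pos_of_pos ht2 _).ne'
            field_simp
        _ ≤ 2 ^ (r * (2 - α)) * r ^ (2 - α) / (1 - α) * A *
            (((n + 1 : ℕ) : ℝ) + 1) ^ (-(min (2 - α) (r * α))) := by
            gcongr
        _ ≤ _ := by
            have : 0 ≤ 1 / α / (1 - α) + (2 ^ α / α + 2 ^ (1 - α) / (1 - α)) := by positivity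
            gcongr
            linarith

lemma abs_interp_le {T r A : ℝ} {N : ℕ} (hT : 0 < T) (hr : 1 ≤ r) (hN : 1 ≤ N) {v : ℕ → ℝ} {k : ℕ}
    (h0 : |v k| ≤ A) (h1 : |v (k + 1)| ≤ A) {y : ℝ}
    (hy : y ∈ Icc (meshTime T r N k) (meshTime T r N (k + 1))) : |interp T r N v k y| ≤ A := by
  rw [abs_le] at *
  refine ⟨?_, interp_le hT hr hN h0.2 h1.2 hy⟩
  have := interp_le hT hr hN (v := fun j => -1 * v j) (k := k) (A := A) (by linarith)
    (by linarith) hy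
  rw [interp_mul] at this
  linarith

lemma history_consistency {α ρ T r A ε C : ℝ} {N Q n : ℕ} {ω s : Fin Q → ℝ} {v : ℝ → ℝ}
    (hα0 : 0 < α) (hα1 : α < 1) (hT : 0 < T) (hr : 1 ≤ r) (hN : 1 ≤ N) (hρ : 0 ≤ ρ) (hε : 0 < ε)
    (h : WeaklySingular α T A v) (hsoe : IsSOE (1 + α) (minStep T r N) T ε ω s) (hn : n + 1 ≤ N)
    (hC : ∑ k ∈ Finset.range n, meshTime T r N (k + 1) ^ α / ((k : ℝ) + 1) ^ 2 *
        (∫ y in meshTime T r N k..meshTime T r N (k + 1),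
          (meshTime T r N (n + 1) - y) ^ (-(1 + α))) ≤
      C * ((n : ℝ) + 1) ^ (-(min (2 - α) (r * α)))) :
    |Real.exp (-ρ * meshTime T r N (n + 1)) * (∫ y in (0 : ℝ)..meshTime T r N n,
        Real.exp (ρ * y) * v y * (meshTime T r N (n + 1) - y) ^ (-(1 + α))) -
      interpConv T r N (soeKernel ρ ω s) (fun j => v (meshTime T r N j)) n| ≤
      ((1 / α + 2 ^ (r * (2 - α)) * r ^ 2) * C + T) * A *
        (((n : ℝ) + 1) ^ (-(min (2 - α) (r * α))) + ε) := by
  have hA := h.nonneg hT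
  have htn := meshTime_strictMono hT hr hN n.lt_succ_self
  have hnT := meshTime_le hT hr hn
  set t := meshTime T r N (n + 1) with ht
  set c := 1 / α + 2 ^ (r * (2 - α)) * r ^ 2 with hc
  have hc0 : 0 ≤ c := by positivity
  set V : ℕ → ℝ := fun j => v (meshTime T r N j) with hV
  have hVA : ∀ j ≤ N, |V j| ≤ A := fun j hj =>
    h.bound _ ⟨meshTime_nonneg hT j, meshTime_le hT hr hj⟩
  have hleft : ∀ k < n, meshTime T r N (k + 1) ≤ meshTime T r N n := fun k hk =>
    meshTime_mono hT hr hk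
  have hmono : ∀ k, meshTime T r N k ≤ meshTime T r N (k + 1) := fun k =>
    meshTime_mono hT hr k.le_succ
  have hint1 : ∀ k < n, IntervalIntegrable
      (fun y => Real.exp (-ρ * t) * (Real.exp (ρ * y) * v y * (t - y) ^ (-(1 + α))))
      MeasureTheory.volume (meshTime T r N k) (meshTime T r N (k + 1)) := by
    intro k hk
    apply ContinuousOn.intervalIntegrable
    rw [uIcc_of_le (hmono k)]
    refine continuousOn_const.mul ((((by fun_prop : Continuous fun y =>
      Real.exp (ρ * y)).continuousOn).mul (h.cont.mono ?_)).mul ?_)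
    · exact Icc_subset_Icc (meshTime_nonneg hT k) ((hleft k hk).trans (htn.le.trans hnT))
    · refine ContinuousOn.rpow_const (by fun_prop) fun y hy => Or.inl ?_
      have h1 := hy.2
      have h2 := hleft k hk
      have : y < t := (h1.trans h2).trans_lt htn
      linarith
  have hint2 : ∀ k, IntervalIntegrable (fun y => soeKernel ρ ω s (t - y) * interp T r N V k y)
      MeasureTheory.volume (meshTime T r N k) (meshTime T r N (k + 1)) := by
    intro k
    apply Continuous.intervalIntegrable
    have := continuous_interp T r N V k
    have := continuous_soeKernel ρ ω s
    fun_prop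
  have hsplit : Real.exp (-ρ * t) * (∫ y in (0 : ℝ)..meshTime T r N n,
        Real.exp (ρ * y) * v y * (t - y) ^ (-(1 + α))) - interpConv T r N (soeKernel ρ ω s) V n =
      ∑ k ∈ Finset.range n, ∫ y in meshTime T r N k..meshTime T r N (k + 1),
        (Real.exp (-ρ * t) * (Real.exp (ρ * y) * v y * (t - y) ^ (-(1 + α))) -
          soeKernel ρ ω s (t - y) * interp T r N V k y) := by
    rw [← intervalIntegral.integral_const_mul, interpConv, ← meshTime_zero (T := T) (N := N) hr,
      ← intervalIntegral.sum_integral_adjacent_intervals hint1, ← Finset.sum_sub_distrib]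
    refine Finset.sum_congr rfl fun k hk => ?_
    rw [intervalIntegral.integral_sub (hint1 k (Finset.mem_range.1 hk)) (hint2 k)]
  rw [hsplit]
  have hterm : ∀ k ∈ Finset.range n, |∫ y in meshTime T r N k..meshTime T r N (k + 1),
        (Real.exp (-ρ * t) * (Real.exp (ρ * y) * v y * (t - y) ^ (-(1 + α))) -
          soeKernel ρ ω s (t - y) * interp T r N V k y)| ≤
      c * A * (meshTime T r N (k + 1) ^ α / ((k : ℝ) + 1) ^ 2 *
        (∫ y in meshTime T r N k..meshTime T r N (k + 1), (t - y) ^ (-(1 + α)))) +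
      ε * A * (meshTime T r N (k + 1) - meshTime T r N k) := by
    intro k hk
    rw [Finset.mem_range] at hk
    have hK := intervalIntegrable_kernel (α := α) (hmono k) ((hleft k hk).trans_lt htn)
    set w := meshTime T r N (k + 1) ^ α / ((k : ℝ) + 1) ^ 2 with hw
    have e : c * A * (w * (∫ y in meshTime T r N k..meshTime T r N (k + 1),
          (t - y) ^ (-(1 + α)))) + ε * A * (meshTime T r N (k + 1) - meshTime T r N k) =
        ∫ y in meshTime T r N k..meshTime T r N (k + 1),
          (c * A * w * (t - y) ^ (-(1 + α)) + ε * A) := by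
      rw [intervalIntegral.integral_add (hK.const_mul _) (by simp),
        intervalIntegral.integral_const_mul, intervalIntegral.integral_const, smul_eq_mul]
      ring
    rw [e, ← Real.norm_eq_abs]
    refine intervalIntegral.norm_integral_le_of_norm_le (hmono k)
      (Filter.Eventually.of_forall fun y hy' => ?_) ((hK.const_mul _).add (by simp))
    have hy : y ∈ Icc (meshTime T r N k) (meshTime T r N (k + 1)) := ⟨hy'.1.le, hy'.2⟩
    have hyn : y ≤ meshTime T r N n := hy.2.trans (hleft k hk)
    have hy0 : 0 ≤ y := (meshTime_nonneg hT k).trans hy.1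
    have hty : 0 < t - y := sub_pos.2 (hyn.trans_lt htn)
    have h1 := abs_sub_interp_le hα0 hα1 hT hr hN h (by omega : k + 1 ≤ N) hy
    have h2 := abs_sub_soeKernel_le hρ hsoe hty.le (mem_Icc_minStep hT hr hn ⟨hy0, hyn⟩)
    have h3 : |interp T r N V k y| ≤ A :=
      abs_interp_le hT hr hN (hVA k (by omega)) (hVA (k + 1) (by omega)) hy
    have hp : 0 ≤ (t - y) ^ (-(1 + α)) := Real.rpow_nonneg hty.le _
    have hE : Real.exp (-ρ * (t - y)) ≤ 1 := by
      rw [Real.exp_le_one_iff]; nlinarith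
    -- Exact kernel times interpolation error, plus kernel error times interpolant. The second part
    -- costs εA per unit of time, hence at most εAT in total.
    have e2 : Real.exp (-ρ * t) * (Real.exp (ρ * y) * v y * (t - y) ^ (-(1 + α))) -
          soeKernel ρ ω s (t - y) * interp T r N V k y =
        Real.exp (-ρ * (t - y)) * (v y - interp T r N V k y) * (t - y) ^ (-(1 + α)) +
        (Real.exp (-ρ * (t - y)) * (t - y) ^ (-(1 + α)) - soeKernel ρ ω s (t - y)) *
          interp T r N V k y := by
      rw [show -ρ * (t - y) = -ρ * t + ρ * y by ring, Real.exp_add]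
      ring
    rw [e2]
    refine (norm_add_le _ _).trans (add_le_add ?_ ?_)
    · rw [Real.norm_eq_abs, abs_mul, abs_mul, abs_of_pos (Real.exp_pos _), abs_of_nonneg hp]
      refine mul_le_mul_of_nonneg_right ?_ hp
      exact (mul_le_of_le_one_left (abs_nonneg _) hE).trans h1
    · rw [Real.norm_eq_abs, abs_mul]
      exact mul_le_mul h2 h3 (abs_nonneg _) hε.le
  refine (Finset.abs_sum_le_sum_abs _ _).trans ((Finset.sum_le_sum hterm).trans ?_)
  rw [Finset.sum_add_distrib, ← Finset.mul_sum, ← Finset.mul_sum,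
    Finset.sum_range_sub (meshTime T r N), meshTime_zero hr, sub_zero]
  have h1 := mul_le_mul_of_nonneg_left hC (mul_nonneg hc0 hA)
  have h2 : ε * A * meshTime T r N n ≤ ε * A * T :=
    mul_le_mul_of_nonneg_left (htn.le.trans hnT) (by positivity)
  have hm : 0 < ((n : ℝ) + 1) ^ (-(min (2 - α) (r * α))) := by positivity
  have hC0 : 0 ≤ C := by
    refine nonneg_of_mul_nonneg_left (le_trans ?_ hC) hm
    refine Finset.sum_nonneg fun k hk => ?_
    have := meshTime_nonneg (r := r) (N := N) hT (k + 1)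
    refine mul_nonneg (by positivity) (intervalIntegral.integral_nonneg (hmono k) fun y hy => ?_)
    have := hleft k (Finset.mem_range.1 hk)
    exact Real.rpow_nonneg (by linarith [hy.2]) _
  have h3 : 0 ≤ c * C * A * ε := by positivity
  have h4 : 0 ≤ T * A * ((n : ℝ) + 1) ^ (-(min (2 - α) (r * α))) := by positivity
  nlinarith

/-- The newest interval interpolates e^{ρt}v while the history interpolates v, with e^{-ρw} kept
exactly in the kernel; hence the two remainders have different shapes. The boundary terms of the
integration by parts on [0, t_n] cancel those of the scheme. -/
lemma fastCaputo_sub_temperedCaputo {α ρ T r A : ℝ} {N Q n : ℕ} {ω s : Fin Q → ℝ} {v : ℝ → ℝ}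
    (hα0 : 0 < α) (hα1 : α < 1) (hT : 0 < T) (hr : 1 ≤ r) (hN : 1 ≤ N) (hρ : 0 ≤ ρ)
    (h : WeaklySingular α T A v) (hs : ∀ i, 0 < s i) (hn : n + 1 ≤ N) :
    fastCaputo α ρ T r N ω s (fun j => v (meshTime T r N j)) (n + 1) -
        temperedCaputo α ρ v (meshTime T r N (n + 1)) =
      1 / Real.Gamma (1 - α) * (Real.exp (-ρ * meshTime T r N (n + 1)) *
        (∫ y in meshTime T r N n..meshTime T r N (n + 1),
          ((Real.exp (ρ * meshTime T r N (n + 1)) * v (meshTime T r N (n + 1)) -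
            Real.exp (ρ * meshTime T r N n) * v (meshTime T r N n)) / meshStep T r N (n + 1) -
            deriv (fun y => Real.exp (ρ * y) * v y) y) * (meshTime T r N (n + 1) - y) ^ (-α)) +
        α * (Real.exp (-ρ * meshTime T r N (n + 1)) * (∫ y in (0 : ℝ)..meshTime T r N n,
          Real.exp (ρ * y) * v y * (meshTime T r N (n + 1) - y) ^ (-(1 + α))) -
          interpConv T r N (soeKernel ρ ω s) (fun j => v (meshTime T r N j)) n)) := by
  have hg := h.exp_mul hα1 hT hρ
  have hgA := hg.nonneg hT
  have hnT := meshTime_le hT hr hn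
  have ha := meshTime_nonneg (r := r) (N := N) hT n
  have ht := meshTime_pos (r := r) hT hN n
  have htn := meshTime_strictMono hT hr hN n.lt_succ_self
  have hτ := meshStep_pos hT hr hN n
  have hI := hg.intervalIntegrable_deriv_mul hα0 hα1 hgA ht hnT
  have hI1 := hI.mono_set (c := 0) (d := meshTime T r N n) (by
    rw [uIcc_of_le ha, uIcc_of_le ht.le]; exact Icc_subset_Icc_right htn.le)
  have hI2 := hI.mono_set (c := meshTime T r N n) (d := meshTime T r N (n + 1)) (by
    rw [uIcc_of_le htn.le, uIcc_of_le ht.le]; exact Icc_subset_Icc_left ha)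
  rw [fastCaputo_succ' hα1 hT hr hN hρ hs, temperedCaputo,
    ← intervalIntegral.integral_add_adjacent_intervals hI1 hI2,
    hg.integral_deriv_mul hα0 ha htn hnT]
  simp only [sub_mul]
  rw [intervalIntegral.integral_sub
    ((WeaklySingular.intervalIntegrable_sub_rpow hα1 _ _ _).const_mul _) hI2,
    intervalIntegral.integral_const_mul, WeaklySingular.integral_sub_rpow hα1, meshTime_zero hr]
  have e0 : meshTime T r N (n + 1) - meshTime T r N n = meshStep T r N (n + 1) := rfl
  have e1 : meshTime T r N (n.succ) - meshTime T r N n = meshStep T r N (n + 1) := rfl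
  simp only [e0, mul_zero, Real.exp_zero, one_mul, Nat.succ_eq_add_one]
  have hE1 : Real.exp (-ρ * meshTime T r N (n + 1)) * Real.exp (ρ * meshTime T r N (n + 1)) = 1 := by
    rw [← Real.exp_add]; simp
  have hE2 : Real.exp (-ρ * meshStep T r N (n + 1)) =
      Real.exp (-ρ * meshTime T r N (n + 1)) * Real.exp (ρ * meshTime T r N n) := by
    rw [← Real.exp_add, meshStep_succ]; ring_nf
  rw [hE2, Real.rpow_sub hτ, Real.rpow_one, Real.rpow_neg hτ.le, Real.rpow_neg ht.le]
  have h1 : meshStep T r N (n + 1) ^ α ≠ 0 := (Real.rpow_pos_of_pos hτ _).ne'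
  have h2 : meshTime T r N (n + 1) ^ α ≠ 0 := (Real.rpow_pos_of_pos ht _).ne'
  have h3 : 1 - α ≠ 0 := by linarith
  have hv : v (meshTime T r N (n + 1)) = Real.exp (-ρ * meshTime T r N (n + 1)) *
      (Real.exp (ρ * meshTime T r N (n + 1)) * v (meshTime T r N (n + 1))) := by
    rw [← mul_assoc, hE1, one_mul]
  set G := Real.exp (ρ * meshTime T r N (n + 1)) * v (meshTime T r N (n + 1))
  rw [hv]
  field_simp
  ring

lemma exists_consistency {α ρ T r : ℝ} (hα0 : 0 < α) (hα1 : α < 1) (hT : 0 < T) (hr : 1 ≤ r)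
    (hρ : 0 ≤ ρ) : ∃ C : ℝ, 0 ≤ C ∧ ∀ (N Q n : ℕ) (ω s : Fin Q → ℝ) (ε A : ℝ) (v : ℝ → ℝ),
      1 ≤ N → 0 < ε → IsSOE (1 + α) (minStep T r N) T ε ω s → WeaklySingular α T A v →
      n + 1 ≤ N →
      |fastCaputo α ρ T r N ω s (fun j => v (meshTime T r N j)) (n + 1) -
        temperedCaputo α ρ v (meshTime T r N (n + 1))| ≤
      C * A * (((n : ℝ) + 1) ^ (-(min (2 - α) (r * α))) + ε) := by
  obtain ⟨C, hC0, hC⟩ := exists_sum_kernel_bound hα0 hα1 hr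
  have h1α : 0 < 1 - α := by linarith
  have hΓ : 0 < Real.Gamma (1 - α) := Real.Gamma_pos_of_pos h1α
  set c₁ := 2 ^ (r * (2 - α)) * r ^ (2 - α) / (1 - α) + 1 / α / (1 - α) +
        (2 ^ α / α + 2 ^ (1 - α) / (1 - α)) with hc₁
  set c₂ := (1 / α + 2 ^ (r * (2 - α)) * r ^ 2) * C + T with hc₂
  have h1 : 0 ≤ c₁ := by positivity
  have h2 : 0 ≤ c₂ := by positivity
  have hE : 0 ≤ expFactor α ρ T := by unfold expFactor; positivity
  refine ⟨1 / Real.Gamma (1 - α) * (c₁ * expFactor α ρ T + α * c₂), by positivity,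
    fun N Q n ω s ε A v hN hε hsoe hv hn => ?_⟩
  have hA := hv.nonneg hT
  rw [fastCaputo_sub_temperedCaputo hα0 hα1 hT hr hN hρ hv hsoe.node_pos hn, abs_mul,
    abs_of_pos (by positivity : 0 < 1 / Real.Gamma (1 - α)), mul_assoc, mul_assoc]
  refine mul_le_mul_of_nonneg_left ?_ (by positivity)
  have b1 := integral_slope_sub_deriv_bound hα0 hα1 hr hT hN (hv.exp_mul hα1 hT hρ) hn
  have b2 := history_consistency hα0 hα1 hT hr hN hρ hε hv hsoe hn (hC T N n hT hN)
  rw [← hc₁] at b1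
  rw [← hc₂] at b2
  have hx : 0 < ((n : ℝ) + 1) ^ (-(min (2 - α) (r * α))) := by positivity
  set x := ((n : ℝ) + 1) ^ (-(min (2 - α) (r * α)))
  refine (abs_add_le _ _).trans ?_
  rw [abs_mul, abs_mul, abs_of_pos (Real.exp_pos _), abs_of_pos hα0]
  have hexp : Real.exp (-ρ * meshTime T r N (n + 1)) ≤ 1 := by
    rw [Real.exp_le_one_iff]
    have := meshTime_nonneg (r := r) (N := N) hT (n + 1)
    nlinarith
  have b3 := (mul_le_of_le_one_left (abs_nonneg _) hexp).trans b1
  have b4 := mul_le_mul_of_nonneg_left b2 hα0.le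
  have h5 : 0 ≤ c₁ * expFactor α ρ T * A * ε := by positivity
  refine (add_le_add b3 b4).trans ?_
  linarith

lemma IsRegular.exists_weaklySingular {α ℓ T : ℝ} {u : ℝ → ℝ → ℝ} (hα0 : 0 < α) (hα1 : α < 1)
    (hT : 0 < T) (h : IsRegular α ℓ T u) :
    ∃ A : ℝ, 0 ≤ A ∧ ∀ x ∈ Ioo 0 ℓ, WeaklySingular α T A (u x) := by
  obtain ⟨K, hK⟩ := h.time_bound
  have hp0 : 0 ≤ T ^ α := by positivity
  have hp1 : 0 ≤ T ^ (1 - α) := by positivity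
  have hp2 : 0 ≤ T ^ (2 - α) := by positivity
  refine ⟨|K| * (1 + T ^ α + T ^ (1 - α) + T ^ (2 - α)), by positivity, fun x hx => ?_⟩
  have h0 := h.time_contDiff x hx
  have h1 : ContDiffOn ℝ 1 (deriv (u x)) (Ioo 0 T) :=
    h0.deriv_of_isOpen isOpen_Ioo (by norm_num)
  have hpow : ∀ t ∈ Ioo 0 T, ∀ m : ℝ, α ≤ m →
      K * (1 + t ^ (α - m)) ≤ |K| * (1 + T ^ (m - α)) * t ^ (α - m) := by
    intro t ht m hm
    have h2 : 1 ≤ T ^ (m - α) * t ^ (α - m) := by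
      have := Real.rpow_le_rpow_of_nonpos ht.1 ht.2.le (by linarith : α - m ≤ 0)
      calc (1 : ℝ) = T ^ (m - α) * T ^ (α - m) := by rw [← Real.rpow_add hT]; simp
        _ ≤ _ := by gcongr
    have h3 : 0 ≤ t ^ (α - m) := Real.rpow_nonneg ht.1.le _
    calc K * (1 + t ^ (α - m)) ≤ |K| * (1 + t ^ (α - m)) :=
          mul_le_mul_of_nonneg_right (le_abs_self K) (by linarith)
      _ ≤ |K| * (T ^ (m - α) * t ^ (α - m) + t ^ (α - m)) := by gcongr
      _ = _ := by ring
  refine ⟨h.time_cont x hx, fun t ht => ?_, fun t ht => ?_, fun t ht => ?_, fun t ht => ?_,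
    fun t ht => ?_⟩
  · exact ((h0.differentiableOn (by norm_num)).differentiableAt
      (isOpen_Ioo.mem_nhds ht)).hasDerivAt
  · exact ((h1.differentiableOn (by norm_num)).differentiableAt
      (isOpen_Ioo.mem_nhds ht)).hasDerivAt
  -- Bounds are given only on the open interval and reach both endpoints by continuity.
  · have hcl : closure (Ioo 0 T) = Icc 0 T := closure_Ioo hT.ne
    refine le_on_closure (s := Ioo 0 T) (f := fun t => |u x t|) (g := fun _ => _) (fun t ht => ?_)
      ?_ continuousOn_const (by rwa [hcl])
    · have h2 := hK x hx t ht 0 (by norm_num)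
      simp only [iteratedDeriv_zero, Nat.cast_zero, sub_zero] at h2
      refine h2.trans ?_
      have h3 : t ^ α ≤ T ^ α := Real.rpow_le_rpow ht.1.le ht.2.le hα0.le
      have h4 : 0 ≤ t ^ α := Real.rpow_nonneg ht.1.le _
      calc _ ≤ |K| * (1 + t ^ α) := mul_le_mul_of_nonneg_right (le_abs_self K) (by linarith)
        _ ≤ _ := mul_le_mul_of_nonneg_left (by linarith) (abs_nonneg K)
    · rw [hcl]
      exact (h.time_cont x hx).abs
  · have h2 := hK x hx t ht 1 (by norm_num)
    rw [iteratedDeriv_one] at h2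
    refine h2.trans ((hpow t ht (1 : ℕ) (by simpa using hα1.le)).trans ?_)
    rw [Nat.cast_one]
    exact mul_le_mul_of_nonneg_right (mul_le_mul_of_nonneg_left (by linarith) (abs_nonneg K))
      (Real.rpow_nonneg ht.1.le _)
  · have h2 := hK x hx t ht 2 le_rfl
    rw [iteratedDeriv_succ, iteratedDeriv_one] at h2
    refine h2.trans ((hpow t ht (2 : ℕ) (by push_cast; linarith)).trans ?_)
    rw [Nat.cast_ofNat]
    exact mul_le_mul_of_nonneg_right (mul_le_mul_of_nonneg_left (by linarith) (abs_nonneg K))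
      (Real.rpow_nonneg ht.1.le _)

/-! ### Spatial truncation error -/

lemma abs_le_of_abs_deriv_le {F F' : ℝ → ℝ} {B z : ℝ} {m : ℕ} (hB : 0 ≤ B) (hz : 0 ≤ z)
    (hF : ContinuousOn F (Icc 0 z)) (h0 : F 0 = 0) (hd : ∀ y ∈ Ioo 0 z, HasDerivAt F (F' y) y)
    (hb : ∀ y ∈ Ioo 0 z, |F' y| ≤ B * y ^ m) : |F z| ≤ B * z ^ (m + 1) := by
  rcases hz.eq_or_lt with rfl | hz
  · simp [h0]
  · obtain ⟨c, hc, hc'⟩ := exists_hasDerivAt_eq_slope F F' hz hF hd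
    rw [h0, sub_zero, sub_zero, eq_div_iff hz.ne'] at hc'
    rw [← hc', abs_mul, abs_of_pos hz, pow_succ, ← mul_assoc]
    refine mul_le_mul_of_nonneg_right ((hb c hc).trans ?_) hz.le
    have := hc.1.le
    have := hc.2.le
    gcongr

/-- Symmetric combinations of w and its derivatives at x ± z vanish at z = 0, so the bound 2K on the
fourth-order combination is lifted through four applications of the mean value theorem. The factors
1/(m+1) of a Taylor remainder are given away. Since x ± h may be boundary points, derivatives are
used only for z < h, and the last application needs just continuity at z = h. -/
lemma abs_second_difference_sub_le {ℓ K x h : ℝ} {w : ℝ → ℝ} (hK : 0 ≤ K) (hh : 0 < h)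
    (hx0 : 0 ≤ x - h) (hxℓ : x + h ≤ ℓ) (hc : ContinuousOn w (Icc 0 ℓ))
    (hd : ContDiffOn ℝ 4 w (Ioo 0 ℓ)) (hb : ∀ y ∈ Ioo 0 ℓ, |iteratedDeriv 4 w y| ≤ K) :
    |(w (x - h) - 2 * w x + w (x + h)) / h ^ 2 - iteratedDeriv 2 w x| ≤ 2 * K * h ^ 2 := by
  have c1 : ContDiffOn ℝ 3 (iteratedDeriv 1 w) (Ioo 0 ℓ) := by
    rw [iteratedDeriv_one]; exact hd.deriv_of_isOpen isOpen_Ioo (by norm_num)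
  have c2 : ContDiffOn ℝ 2 (iteratedDeriv 2 w) (Ioo 0 ℓ) := by
    rw [iteratedDeriv_succ]; exact c1.deriv_of_isOpen isOpen_Ioo (by norm_num)
  have c3 : ContDiffOn ℝ 1 (iteratedDeriv 3 w) (Ioo 0 ℓ) := by
    rw [iteratedDeriv_succ]; exact c2.deriv_of_isOpen isOpen_Ioo (by norm_num)
  have hder : ∀ j < 4, ∀ y ∈ Ioo 0 ℓ,
      HasDerivAt (iteratedDeriv j w) (iteratedDeriv (j + 1) w y) y := by
    intro j hj y hy
    rw [iteratedDeriv_succ]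
    refine DifferentiableAt.hasDerivAt ?_
    have hn := isOpen_Ioo.mem_nhds hy
    interval_cases j
    · rw [iteratedDeriv_zero]; exact (hd.differentiableOn (by norm_num)).differentiableAt hn
    · exact (c1.differentiableOn (by norm_num)).differentiableAt hn
    · exact (c2.differentiableOn (by norm_num)).differentiableAt hn
    · exact (c3.differentiableOn (by norm_num)).differentiableAt hn
  have hplus : ∀ z ∈ Ico 0 h, x + z ∈ Ioo 0 ℓ := fun z hz =>
    ⟨by linarith [hz.1, hz.2], by linarith [hz.1, hz.2]⟩
  have hminus : ∀ z ∈ Ico 0 h, x - z ∈ Ioo 0 ℓ := fun z hz =>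
    ⟨by linarith [hz.1, hz.2], by linarith [hz.1, hz.2]⟩
  have dplus : ∀ j < 4, ∀ z ∈ Ico 0 h, HasDerivAt (fun z => iteratedDeriv j w (x + z))
      (iteratedDeriv (j + 1) w (x + z)) z := fun j hj z hz => by
    exact ((hder j hj _ (hplus z hz)).comp z ((hasDerivAt_id z).const_add x)).congr_deriv (by ring)
  have dminus : ∀ j < 4, ∀ z ∈ Ico 0 h, HasDerivAt (fun z => iteratedDeriv j w (x - z))
      (-iteratedDeriv (j + 1) w (x - z)) z := fun j hj z hz => by
    exact ((hder j hj _ (hminus z hz)).comp z ((hasDerivAt_id z).const_sub x)).congr_deriv (by ring)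
  have hIco : ∀ z ∈ Ico 0 h, ∀ y ∈ Icc 0 z, y ∈ Ico 0 h := fun z hz y hy =>
    ⟨hy.1, hy.2.trans_lt hz.2⟩
  have e3 : ∀ z ∈ Ico 0 h, |iteratedDeriv 3 w (x + z) - iteratedDeriv 3 w (x - z)| ≤
      2 * K * z ^ (0 + 1) := by
    intro z hz
    have hD : ∀ y ∈ Icc 0 z, HasDerivAt
        (fun z => iteratedDeriv 3 w (x + z) - iteratedDeriv 3 w (x - z))
        (iteratedDeriv 4 w (x + y) + iteratedDeriv 4 w (x - y)) y := fun y hy =>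
      ((dplus 3 (by norm_num) y (hIco z hz y hy)).sub
        (dminus 3 (by norm_num) y (hIco z hz y hy))).congr_deriv (by ring)
    refine abs_le_of_abs_deriv_le (by positivity) hz.1
      (fun y hy => (hD y hy).continuousAt.continuousWithinAt) (by simp)
      (fun y hy => hD y ⟨hy.1.le, hy.2.le⟩) fun y hy => ?_
    have hy' := hIco z hz y ⟨hy.1.le, hy.2.le⟩
    have := (abs_add_le _ _).trans (add_le_add (hb _ (hplus y hy')) (hb _ (hminus y hy')))
    rw [pow_zero]
    linarith
  have e2 : ∀ z ∈ Ico 0 h, |iteratedDeriv 2 w (x + z) + iteratedDeriv 2 w (x - z) -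
      2 * iteratedDeriv 2 w x| ≤ 2 * K * z ^ (1 + 1) := by
    intro z hz
    have hD : ∀ y ∈ Icc 0 z, HasDerivAt (fun z => iteratedDeriv 2 w (x + z) +
        iteratedDeriv 2 w (x - z) - 2 * iteratedDeriv 2 w x)
        (iteratedDeriv 3 w (x + y) - iteratedDeriv 3 w (x - y)) y := fun y hy =>
      (((dplus 2 (by norm_num) y (hIco z hz y hy)).add
        (dminus 2 (by norm_num) y (hIco z hz y hy))).sub_const _).congr_deriv (by ring)
    exact abs_le_of_abs_deriv_le (by positivity) hz.1
      (fun y hy => (hD y hy).continuousAt.continuousWithinAt) (by simp; ring)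
      (fun y hy => hD y ⟨hy.1.le, hy.2.le⟩)
      fun y hy => e3 y (hIco z hz y ⟨hy.1.le, hy.2.le⟩)
  have e1 : ∀ z ∈ Ico 0 h, |iteratedDeriv 1 w (x + z) - iteratedDeriv 1 w (x - z) -
      2 * z * iteratedDeriv 2 w x| ≤ 2 * K * z ^ (2 + 1) := by
    intro z hz
    have hD : ∀ y ∈ Icc 0 z, HasDerivAt (fun z => iteratedDeriv 1 w (x + z) -
        iteratedDeriv 1 w (x - z) - 2 * z * iteratedDeriv 2 w x)
        (iteratedDeriv 2 w (x + y) + iteratedDeriv 2 w (x - y) - 2 * iteratedDeriv 2 w x) y :=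
      fun y hy => (((dplus 1 (by norm_num) y (hIco z hz y hy)).sub
        (dminus 1 (by norm_num) y (hIco z hz y hy))).sub
        (((hasDerivAt_id y).const_mul 2).mul_const _)).congr_deriv (by ring)
    exact abs_le_of_abs_deriv_le (by positivity) hz.1
      (fun y hy => (hD y hy).continuousAt.continuousWithinAt) (by simp)
      (fun y hy => hD y ⟨hy.1.le, hy.2.le⟩)
      fun y hy => e2 y (hIco z hz y ⟨hy.1.le, hy.2.le⟩)
  have e0 : |w (x + h) + w (x - h) - 2 * w x - h ^ 2 * iteratedDeriv 2 w x| ≤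
      2 * K * h ^ (3 + 1) := by
    refine abs_le_of_abs_deriv_le
      (F := fun z => w (x + z) + w (x - z) - 2 * w x - z ^ 2 * iteratedDeriv 2 w x)
      (F' := fun z => iteratedDeriv 1 w (x + z) - iteratedDeriv 1 w (x - z) -
        2 * z * iteratedDeriv 2 w x) (by positivity) hh.le ?_ (by simp; ring)
      (fun y hy => ?_) (fun y hy => e1 y ⟨hy.1.le, hy.2⟩)
    · refine (((ContinuousOn.add ?_ ?_).sub continuousOn_const).sub
        (by fun_prop : Continuous fun z : ℝ => z ^ 2 * iteratedDeriv 2 w x).continuousOn)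
      · exact hc.comp (by fun_prop) fun y hy => ⟨by linarith [hy.1], by linarith [hy.2]⟩
      · exact hc.comp (by fun_prop) fun y hy => ⟨by linarith [hy.2], by linarith [hy.1]⟩
    · have d1 := dplus 0 (by norm_num) y ⟨hy.1.le, hy.2⟩
      have d2 := dminus 0 (by norm_num) y ⟨hy.1.le, hy.2⟩
      rw [iteratedDeriv_zero] at d1 d2
      exact (((d1.add d2).sub_const _).sub ((hasDerivAt_pow 2 y).mul_const _)).congr_deriv
        (by push_cast; ring)
  have e : (w (x - h) - 2 * w x + w (x + h)) / h ^ 2 - iteratedDeriv 2 w x =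
      (w (x + h) + w (x - h) - 2 * w x - h ^ 2 * iteratedDeriv 2 w x) / h ^ 2 := by
    field_simp
    ring
  rw [e, abs_div, abs_of_pos (by positivity : 0 < h ^ 2), div_le_iff₀ (by positivity)]
  refine e0.trans (le_of_eq (by ring))

/-! ### Stability: the weighted discrete maximum principle -/

section maximum

variable {α ρ D T r γ ε h R θ : ℝ} {N Q n i : ℕ} {ω s : Fin Q → ℝ} {e : ℕ → ℕ → ℝ}

/-- The error touches θ times the barrier from below at the newest time, so comparison bounds its
fast derivative below by θ t^{-α}/(2Γ(1-α)). At a spatial maximum the diffusion term only helps. -/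
lemma weight_le_of_residual_le (hα0 : 0 < α) (hα1 : α < 1) (hT : 0 < T) (hr : 1 ≤ r) (hN : 1 ≤ N)
    (hρ : 0 ≤ ρ) (hD : 0 ≤ D) (hγ : 0 < γ) (hε : 0 < ε) (hsoe : IsSOE (1 + α) (minStep T r N) T ε ω s)
    (hεγ : α * (ε / γ) ≤ T ^ (-α) / 2) (hn : n + 1 ≤ N) (hθ : 0 ≤ θ)
    (hmax : e i (n + 1) = θ * barrier T r N γ (n + 1))
    (hle : ∀ k ≤ n, e i k ≤ θ * barrier T r N γ k)
    (hl : e (i - 1) (n + 1) ≤ e i (n + 1)) (hrt : e (i + 1) (n + 1) ≤ e i (n + 1))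
    (hR : fastCaputo α ρ T r N ω s (e i) (n + 1) -
      D * centralDiff h (fun j => e j (n + 1)) i ≤ R) :
    θ ≤ 2 * Real.Gamma (1 - α) * (meshTime T r N (n + 1) ^ α * R) := by
  have h1 := fastCaputo_le_of_le (ρ := ρ) hα0 hα1 hT hr hN hρ hsoe.node_pos hsoe.weight_pos hle hmax
  rw [fastCaputo_mul hα1 hT hr hN hρ hsoe.node_pos] at h1
  have h2 := mul_le_mul_of_nonneg_left
    (le_fastCaputo_barrier hα0 hα1 hT hr hN hρ hγ hε hsoe hn hεγ) hθ
  have h3 : D * centralDiff h (fun j => e j (n + 1)) i ≤ 0 :=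
    mul_nonpos_of_nonneg_of_nonpos hD
      (div_nonpos_of_nonpos_of_nonneg (by linarith) (sq_nonneg h))
  have h4 := (h2.trans h1).trans (by linarith : _ ≤ R)
  have hΓ : 0 < Real.Gamma (1 - α) := Real.Gamma_pos_of_pos (by linarith)
  have ht := meshTime_pos (r := r) hT hN n
  have hp : 0 < meshTime T r N (n + 1) ^ α := by positivity
  rw [Real.rpow_neg ht.le] at h4
  have h5 := mul_le_mul_of_nonneg_left h4
    (by positivity : 0 ≤ 2 * Real.Gamma (1 - α) * meshTime T r N (n + 1) ^ α)
  refine le_trans (le_of_eq ?_) (h5.trans (le_of_eq (by ring)))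
  field_simp

/-- Weighted discrete maximum principle for the fast scheme. -/
lemma abs_le_of_residual_le {M : ℕ} {B : ℝ} (hα0 : 0 < α) (hα1 : α < 1) (hT : 0 < T) (hr : 1 ≤ r)
    (hN : 1 ≤ N) (hρ : 0 ≤ ρ) (hD : 0 ≤ D) (hγ : 0 < γ) (hε : 0 < ε)
    (hsoe : IsSOE (1 + α) (minStep T r N) T ε ω s) (hεγ : α * (ε / γ) ≤ T ^ (-α) / 2)
    (hB : 0 ≤ B) (hinit : ∀ i ≤ M, e i 0 = 0) (hleft : ∀ n, 0 < n → n ≤ N → e 0 n = 0)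
    (hright : ∀ n, 0 < n → n ≤ N → e M n = 0)
    (hres : ∀ i n, 1 ≤ i → i < M → n + 1 ≤ N → meshTime T r N (n + 1) ^ α *
      |fastCaputo α ρ T r N ω s (e i) (n + 1) - D * centralDiff h (fun j => e j (n + 1)) i| ≤ B)
    (hi : i ≤ M) (hn : n ≤ N) :
    |e i n| ≤ Real.exp (γ * T) * (2 * Real.Gamma (1 - α) * B) := by
  have hΓ : 0 < Real.Gamma (1 - α) := Real.Gamma_pos_of_pos (by linarith)
  -- One maximum over the whole space-time grid replaces an induction in time: its value θ scales
  -- the barrier so that it dominates the error everywhere and touches it there.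
  obtain ⟨⟨i₀, n₀⟩, hmem, hmax⟩ := Finset.exists_max_image
    (Finset.range (M + 1) ×ˢ Finset.range (N + 1))
    (fun p => |e p.1 p.2| * Real.exp (-(γ * meshTime T r N p.2))) ⟨(0, 0), by simp⟩
  simp only [Finset.mem_product, Finset.mem_range, Prod.forall] at hmem hmax
  set θ := |e i₀ n₀| * Real.exp (-(γ * meshTime T r N n₀)) with hθ
  have hθ0 : 0 ≤ θ := by positivity
  have hall : ∀ j k, j ≤ M → k ≤ N → |e j k| ≤ θ * Real.exp (γ * meshTime T r N k) := by
    intro j k hj hk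
    have := mul_le_mul_of_nonneg_right (hmax j k ⟨by omega, by omega⟩)
      (Real.exp_pos (γ * meshTime T r N k)).le
    rwa [mul_assoc, ← Real.exp_add, neg_add_cancel, Real.exp_zero, mul_one] at this
  suffices hθB : θ ≤ 2 * Real.Gamma (1 - α) * B by
    refine (hall i n hi hn).trans ?_
    rw [mul_comm]
    refine mul_le_mul (Real.exp_le_exp.2 ?_) hθB hθ0 (Real.exp_pos _).le
    exact mul_le_mul_of_nonneg_left (meshTime_le hT hr hn) hγ.le
  have hzero : e i₀ n₀ = 0 → θ ≤ 2 * Real.Gamma (1 - α) * B := fun h0 => by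
    rw [hθ, h0, abs_zero, zero_mul]
    positivity
  rcases n₀ with _ | m
  · exact hzero (hinit i₀ (by omega))
  rcases Nat.eq_zero_or_pos i₀ with hi0 | hi0
  · exact hzero (hi0 ▸ hleft _ (by omega) (by omega))
  rcases (by omega : i₀ = M ∨ i₀ < M) with hiM | hiM
  · exact hzero (hiM ▸ hright _ (by omega) (by omega))
  have hb : barrier T r N γ (m + 1) = Real.exp (γ * meshTime T r N (m + 1)) := by
    rw [barrier, if_neg (by omega)]
  have heq : |e i₀ (m + 1)| = θ * barrier T r N γ (m + 1) := by
    rw [hb, hθ, mul_assoc, ← Real.exp_add, neg_add_cancel, Real.exp_zero, mul_one]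
  have hle : ∀ k ≤ m, |e i₀ k| ≤ θ * barrier T r N γ k := by
    intro k hk
    rcases Nat.eq_zero_or_pos k with rfl | hk0
    -- At time 0 the barrier vanishes, and only the zero initial error makes the comparison
    -- possible.
    · simp [hinit i₀ hiM.le, barrier]
    · rw [barrier, if_neg (by omega)]
      exact hall i₀ k hiM.le (by omega)
  have hl : |e (i₀ - 1) (m + 1)| ≤ |e i₀ (m + 1)| := by
    rw [heq, hb]; exact hall _ _ (by omega) (by omega)
  have hrt : |e (i₀ + 1) (m + 1)| ≤ |e i₀ (m + 1)| := by
    rw [heq, hb]; exact hall _ _ (by omega) (by omega)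
  have hr' := hres i₀ m hi0 hiM (by omega)
  have hmul := mul_le_mul_of_nonneg_left hr' (by positivity : 0 ≤ 2 * Real.Gamma (1 - α))
  refine le_trans ?_ hmul
  rcases le_total 0 (e i₀ (m + 1)) with hs | hs
  · rw [abs_of_nonneg hs] at heq hl hrt
    exact weight_le_of_residual_le hα0 hα1 hT hr hN hρ hD hγ hε hsoe hεγ (by omega) hθ0 heq
      (fun k hk => (le_abs_self _).trans (hle k hk)) ((le_abs_self _).trans hl)
      ((le_abs_self _).trans hrt) (le_abs_self _)
  · rw [abs_of_nonpos hs] at heq hl hrt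
    refine weight_le_of_residual_le (e := fun j k => -1 * e j k) (i := i₀) (h := h) hα0 hα1 hT hr hN
      hρ hD hγ hε hsoe hεγ (by omega) hθ0 (by linarith)
      (fun k hk => by linarith [neg_abs_le (e i₀ k), hle k hk])
      (by linarith [neg_abs_le (e (i₀ - 1) (m + 1))])
      (by linarith [neg_abs_le (e (i₀ + 1) (m + 1))]) (le_trans (le_of_eq ?_) (neg_le_abs _))
    rw [fastCaputo_mul hα1 hT hr hN hρ hsoe.node_pos]
    simp only [centralDiff]
    ring

end maximum

/-! ### Assembling the error estimate -/

lemma meshTime_rpow_mul_le {α T r : ℝ} {N n : ℕ} (hT : 0 < T) (hN : 1 ≤ N)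
    (hn : n + 1 ≤ N) :
    meshTime T r N (n + 1) ^ α * ((n : ℝ) + 1) ^ (-(min (2 - α) (r * α))) ≤
      T ^ α * (N : ℝ) ^ (-(min (2 - α) (r * α))) := by
  have hN' : (0 : ℝ) < N := by exact_mod_cast hN
  have hm : (0 : ℝ) < (n : ℝ) + 1 := by positivity
  have hmN : (n : ℝ) + 1 ≤ N := by exact_mod_cast hn
  -- The stability weight is T^α ((n+1)/N)^{rα}. Lowering its exponent to β cancels (n+1)^{-β} and
  -- leaves N^{-β}.
  have h1 : (((n : ℝ) + 1) / N) ^ (r * α) ≤ (((n : ℝ) + 1) / N) ^ (min (2 - α) (r * α)) :=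
    Real.rpow_le_rpow_of_exponent_ge (by positivity) (div_le_one_of_le₀ hmN hN'.le)
      (min_le_right _ _)
  unfold meshTime
  rw [Real.mul_rpow hT.le (by positivity), ← Real.rpow_mul (by positivity), Nat.cast_add_one,
    mul_assoc]
  refine mul_le_mul_of_nonneg_left ?_ (by positivity)
  refine (mul_le_mul_of_nonneg_right h1 (by positivity)).trans (le_of_eq ?_)
  rw [Real.div_rpow hm.le hN'.le, Real.rpow_neg hm.le, Real.rpow_neg hN'.le]
  have : ((n : ℝ) + 1) ^ (min (2 - α) (r * α)) ≠ 0 := (Real.rpow_pos_of_pos hm _).ne'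
  field_simp

/-- The residual of the error in the fast scheme is the sum of the temporal and the spatial
truncation errors. -/
lemma error_residual {α ρ D ℓ T r : ℝ} {f : ℝ → ℝ → ℝ} {ψ : ℝ → ℝ} {u : ℝ → ℝ → ℝ} {M N Q n i : ℕ}
    {ω s : Fin Q → ℝ} {U : ℕ → ℕ → ℝ} (hα1 : α < 1) (hρ : 0 ≤ ρ) (hℓ : 0 < ℓ)
    (hT : 0 < T) (hr : 1 ≤ r) (hN : 1 ≤ N) (hu : IsSolution α ρ D ℓ T f ψ u)
    (hs : ∀ i, 0 < s i) (hU : IsFastScheme α ρ D ℓ T r f ψ M N ω s U) (hi : 1 ≤ i) (hiM : i < M)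
    (hn : n + 1 ≤ N) :
    fastCaputo α ρ T r N ω s (fun k => u (i * (ℓ / M)) (meshTime T r N k) - U i k) (n + 1) -
        D * centralDiff (ℓ / M)
          (fun j => u (j * (ℓ / M)) (meshTime T r N (n + 1)) - U j (n + 1)) i =
      (fastCaputo α ρ T r N ω s (fun k => u (i * (ℓ / M)) (meshTime T r N k)) (n + 1) -
        temperedCaputo α ρ (u (i * (ℓ / M))) (meshTime T r N (n + 1))) -
      D * (centralDiff (ℓ / M) (fun j => u (j * (ℓ / M)) (meshTime T r N (n + 1))) i -
        iteratedDeriv 2 (fun y => u y (meshTime T r N (n + 1))) (i * (ℓ / M))) := by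
  have hM : (0 : ℝ) < M := by exact_mod_cast (by omega : 0 < M)
  have hi' : (0 : ℝ) < i := by exact_mod_cast hi
  have hiM' : (i : ℝ) < M := by exact_mod_cast hiM
  have hx : (i : ℝ) * (ℓ / M) ∈ Ioo 0 ℓ := by
    refine ⟨by positivity, ?_⟩
    rw [← mul_div_assoc, div_lt_iff₀ hM]
    nlinarith
  have h1 := hu.equation _ hx (meshTime T r N (n + 1)) ⟨meshTime_pos hT hN n, meshTime_le hT hr hn⟩
  have h2 := hU.equation i (n + 1) hi hiM (by omega) hn
  rw [fastCaputo_sub hα1 hT hr hN hρ hs, h2]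
  change temperedCaputo α ρ (u (i * (ℓ / M))) _ = _ at h1
  rw [h1]
  simp only [centralDiff]
  ring

lemma abs_centralDiff_sub_le {ℓ K : ℝ} {w : ℝ → ℝ} {M i : ℕ} (hℓ : 0 < ℓ) (hK : 0 ≤ K)
    (hc : ContinuousOn w (Icc 0 ℓ)) (hd : ContDiffOn ℝ 4 w (Ioo 0 ℓ))
    (hb : ∀ y ∈ Ioo 0 ℓ, |iteratedDeriv 4 w y| ≤ K) (hi : 1 ≤ i) (hiM : i < M) :
    |centralDiff (ℓ / M) (fun j => w (j * (ℓ / M))) i - iteratedDeriv 2 w (i * (ℓ / M))| ≤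
      2 * K * (ℓ / M) ^ 2 := by
  have hM : (0 : ℝ) < M := by exact_mod_cast (by omega : 0 < M)
  have hi' : (1 : ℝ) ≤ i := by exact_mod_cast hi
  have hiM' : (i : ℝ) + 1 ≤ M := by exact_mod_cast hiM
  have hh : 0 < ℓ / M := by positivity
  have hMh : (M : ℝ) * (ℓ / M) = ℓ := by field_simp
  have h := abs_second_difference_sub_le (x := i * (ℓ / M)) hK hh (by nlinarith)
    (by nlinarith) hc hd hb
  have e1 : ((i - 1 : ℕ) : ℝ) * (ℓ / M) = i * (ℓ / M) - ℓ / M := by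
    rw [Nat.cast_sub hi]; push_cast; ring
  have e2 : ((i + 1 : ℕ) : ℝ) * (ℓ / M) = i * (ℓ / M) + ℓ / M := by push_cast; ring
  simpa only [centralDiff, e1, e2] using h

end TemperedDiffusion

end

theorem theorem4p3 (α ρ D ℓ T r : ℝ) (hα0 : 0 < α) (hα1 : α < 1) (hρ : 0 ≤ ρ) (hD : 0 < D)
    (hℓ : 0 < ℓ) (hT : 0 < T) (hr : 1 ≤ r)
    (f : ℝ → ℝ → ℝ) (ψ : ℝ → ℝ) (u : ℝ → ℝ → ℝ)
    (hu : TemperedDiffusion.IsSolution α ρ D ℓ T f ψ u)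
    (hreg : TemperedDiffusion.IsRegular α ℓ T u)
    (ε₀ : ℝ) :
    ∃ C : ℝ, 0 < C ∧
      ∀ (M N : ℕ), 1 ≤ M → 1 ≤ N →
      ∀ ε : ℝ, 0 < ε → ε ≤ ε₀ →
      ∀ (Q : ℕ) (ω s : Fin Q → ℝ),
        TemperedDiffusion.IsSOE (1 + α) (TemperedDiffusion.minStep T r N) T ε ω s →
      ∀ U : ℕ → ℕ → ℝ,
        TemperedDiffusion.IsFastScheme α ρ D ℓ T r f ψ M N ω s U →
      ∀ n : ℕ, n ≤ N →
        ‖fun i : Fin (M + 1) =>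
            u ((i : ℕ) * (ℓ / M)) (TemperedDiffusion.meshTime T r N n) - U i n‖ ≤
          C * ((ℓ / M) ^ 2 + T ^ α * (N : ℝ) ^ (-(min (2 - α) (r * α))) + ε) := by
  open TemperedDiffusion in
  obtain ⟨A, hA, hv⟩ := hreg.exists_weaklySingular hα0 hα1 hT
  obtain ⟨c, hc, hcons⟩ := exists_consistency (ρ := ρ) hα0 hα1 hT hr hρ
  obtain ⟨K, hK⟩ := hreg.space_bound
  have hΓ : 0 < Real.Gamma (1 - α) := Real.Gamma_pos_of_pos (by linarith)
  -- Chosen so that αε/γ ≤ T^{-α}/2 for every ε ≤ ε₀; the dependence of the constant on ε₀ enters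
  -- here. The form |ε₀| + 1 keeps γ positive whatever the sign of ε₀.
  set γ := 2 * α * (|ε₀| + 1) * T ^ α with hγdef
  have hγ : 0 < γ := by positivity
  set B := c * A * (1 + T ^ α) + T ^ α * D * (2 * |K|) with hB
  have hB0 : 0 ≤ B := by positivity
  -- The added 1 keeps the constant positive when B = 0.
  refine ⟨Real.exp (γ * T) * (2 * Real.Gamma (1 - α) * B) + 1, by positivity,
    fun M N hM hN ε hε hεε₀ Q ω s hsoe U hU n hn => ?_⟩
  have hM' : (0 : ℝ) < M := by exact_mod_cast hM
  have hMh : (M : ℝ) * (ℓ / M) = ℓ := by field_simp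
  have hh : 0 < ℓ / M := by positivity
  set E := (ℓ / M) ^ 2 + T ^ α * (N : ℝ) ^ (-(min (2 - α) (r * α))) + ε with hE
  have hE0 : 0 ≤ E := by positivity
  have hεγ : α * (ε / γ) ≤ T ^ (-α) / 2 := by
    rw [Real.rpow_neg hT.le, ← mul_div_assoc, div_le_iff₀ hγ, hγdef]
    have h1 : (T ^ α)⁻¹ / 2 * (2 * α * (|ε₀| + 1) * T ^ α) = α * (|ε₀| + 1) := by
      field_simp
    rw [h1]
    exact mul_le_mul_of_nonneg_left (by linarith [le_abs_self ε₀]) hα0.le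
  rw [pi_norm_le_iff_of_nonneg (by positivity)]
  intro i
  have key := abs_le_of_residual_le (M := M) (h := ℓ / M) (B := B * E) (i := i) (n := n)
    (e := fun j k => u (j * (ℓ / M)) (meshTime T r N k) - U j k)
    hα0 hα1 hT hr hN hρ hD.le hγ hε hsoe hεγ (by positivity) ?_ ?_ ?_ ?_ (by omega) hn
  · refine key.trans ?_
    have : Real.exp (γ * T) * (2 * Real.Gamma (1 - α) * (B * E)) =
        Real.exp (γ * T) * (2 * Real.Gamma (1 - α) * B) * E := by ring
    rw [this]
    exact mul_le_mul_of_nonneg_right (by linarith) hE0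
  · intro j hj
    have hj' : (j : ℝ) ≤ M := by exact_mod_cast hj
    simp only [hU.initial j hj, meshTime_zero hr]
    rw [hu.initial _ ⟨by positivity, by nlinarith⟩, sub_self]
  · intro k hk hkN
    obtain ⟨k, rfl⟩ := Nat.exists_eq_succ_of_ne_zero hk.ne'
    simp only [hU.boundary_left _ hk hkN, Nat.cast_zero, zero_mul]
    rw [hu.boundary_left _ ⟨meshTime_pos hT hN k, meshTime_le hT hr hkN⟩, sub_zero]
  · intro k hk hkN
    obtain ⟨k, rfl⟩ := Nat.exists_eq_succ_of_ne_zero hk.ne'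
    simp only [hU.boundary_right _ hk hkN, hMh]
    rw [hu.boundary_right _ ⟨meshTime_pos hT hN k, meshTime_le hT hr hkN⟩, sub_zero]
  · intro j k hj hjM hk
    rw [error_residual hα1 hρ hℓ hT hr hN hu hsoe.node_pos hU hj hjM hk]
    have htk := meshTime_pos (r := r) hT hN k
    have htT := meshTime_le hT hr hk
    have ht : meshTime T r N (k + 1) ∈ Ioc 0 T := ⟨htk, htT⟩
    have hj' : (0 : ℝ) < j := by exact_mod_cast hj
    have hjM' : (j : ℝ) < M := by exact_mod_cast hjM
    have hx : (j : ℝ) * (ℓ / M) ∈ Ioo 0 ℓ := ⟨by positivity, by nlinarith⟩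
    have b1 := hcons N Q k ω s ε A (u (j * (ℓ / M))) hN hε hsoe (hv _ hx) hk
    have b2 := abs_centralDiff_sub_le hℓ (abs_nonneg K) (hreg.space_cont _ ht)
      (hreg.space_contDiff _ ht) (fun y hy => (hK _ ht y hy).trans (le_abs_self K)) hj hjM
    have b3 := meshTime_rpow_mul_le (α := α) (r := r) hT hN hk
    have b4 : meshTime T r N (k + 1) ^ α ≤ T ^ α := Real.rpow_le_rpow htk.le htT hα0.le
    have hp : 0 ≤ meshTime T r N (k + 1) ^ α := by positivity
    set p := meshTime T r N (k + 1) ^ α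
    set x := ((k : ℝ) + 1) ^ (-(min (2 - α) (r * α)))
    set y := T ^ α * (N : ℝ) ^ (-(min (2 - α) (r * α))) with hy
    have hy0 : 0 ≤ y := by positivity
    have hTα : 0 ≤ T ^ α := by positivity
    -- The weight t^α is needed in full only for the term (k+1)^{-β}; against ε and h² it is simply
    -- bounded by T^α.
    refine (mul_le_mul_of_nonneg_left ((abs_sub _ _).trans (add_le_add b1 ?_)) hp).trans
      (b := p * (c * A * (x + ε) + D * (2 * |K| * (ℓ / M) ^ 2))) ?_
    · rw [abs_mul, abs_of_pos hD]
      exact mul_le_mul_of_nonneg_left b2 hD.le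
    · calc p * (c * A * (x + ε) + D * (2 * |K| * (ℓ / M) ^ 2))
          = c * A * (p * x + p * ε) + p * D * (2 * |K| * (ℓ / M) ^ 2) := by ring
        _ ≤ c * A * (y + T ^ α * ε) + T ^ α * D * (2 * |K| * (ℓ / M) ^ 2) := by gcongr
        _ ≤ c * A * ((1 + T ^ α) * E) + T ^ α * D * (2 * |K| * E) := by
            have h1 : y + T ^ α * ε ≤ (1 + T ^ α) * E := by
              have h2 : y + ε ≤ E := by rw [hE]; linarith [sq_nonneg (ℓ / (M : ℝ))]
              nlinarith [mul_nonneg hTα hy0]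
            have h3 : (ℓ / M) ^ 2 ≤ E := by rw [hE]; linarith
            gcongr
        _ = B * E := by rw [hB]; ring
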